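/- Let $B_n$ be the braid group with generators $\sigma_1,\dots,\sigma_{n-1}$ and Artin's relations, let $P_n$ be the pure braid group (the kernel of $B_n\to S_n$, $\sigma_i\mapsto(i\ i{+}1)$), and let $B_n\subset B_{n+1}$ by adding a straight last strand. Let $F_n$ be the free group on $g_1,\dots,g_n$ and form $F_n\rtimes B_n$ with the relations $g_{i+1}\sigma_i=\sigma_i g_i$, $g_i\sigma_i=\sigma_i g_ig_{i+1}g_i^{-1}$, and $g_j\sigma_i=\sigma_ig_j$ for $j\notin\{i,i+1\}$. Let $k$ be a commutative ring (for example $\mathbf C$), $V$ a $k$-module, $n\ge 0$, and $\rho\colon P_{n+1}\to\mathrm{GL}(V)$ a representation. Then: 1. There is a homomorphism $\phi$ from $B_n$ to the group of invertible $n\times n$ matrices over $\mathbf Z[F_n\rtimes B_n]$ such that $\phi(\sigma_i)=\sigma_i\cdot\left(I_{i-1}\oplus\begin{pmatrix}0&g_i\\1&1-g_i\end{pmatrix}\oplus I_{n-i-1}\right)$, where $\sigma_i$ multiplies each entry on the left. 2. There is an isomorphism $F_n\rtimes P_n\cong P_{n+1}$ that sends $g_i$ to $(\sigma_n\cdots\sigma_{i+1})\,\sigma_i^2\,(\sigma_n\cdots\sigma_{i+1})^{-1}$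 and is the inclusion $P_n\subset P_{n+1}$ on $P_n$. Identify the two groups by it. 3. For all $t=(t_1,\dots,t_n)\in(k^\times)^n$ there is a unique representation $\rho_t\colon P_{n+1}\to\mathrm{GL}(V)$ with $\rho_t(g_i)=t_i\,\rho(g_i)$ for $i=1,\dots,n$ and $\rho_t(\beta)=\rho(\beta)$ for all $\beta\in P_n$. 4. For $\beta\in P_n$ all entries of $\phi(\beta)$ lie in $\mathbf Z[F_n\rtimes P_n]$, and the block matrices $\rho^+_t(\beta)=\bigl(\rho_t(\phi(\beta)_{ij})\bigr)_{i,j}$, with $\rho_t$ extended linearly to the group ring, define a representation $\rho^+_t=\rho^+_{t_1,\dots,t_n}\colon P_n\to\mathrm{GL}(V^{\oplus n})$, for every $t\in(k^\times)^n$. 5. If $\rho$ is trivial, then for every $t$ the representation $\rho^+_t$ is isomorphic to the unreduced Gassner representation on $V^{\oplus n}$; for $V=k$ it is the unreduced Gassner representation on $k^n$, up to a change of basis. Here the unreduced Gassner representation sends $\beta\in P_n$ to the matrix of Fox derivatives $\left(\dfrac{\partial(\beta^{-1}g_i\beta)}{\partial g_j}\right)_{i,j}$ evaluated at $g_l=t_l$,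 where $\beta^{-1}g_i\beta\in F_n$ is computed in $F_n\rtimes B_n$ and the Fox derivatives are determined by $\partial g_i/\partial g_j=\delta_{ij}$ and $\partial(uv)/\partial g_j=\partial u/\partial g_j+u\,\partial v/\partial g_j$. -/

import Mathlib

namespace Braid

/-- The left strand position `i` moved by the generator `σ i` (positions are counted from `0`). -/
def lo {n : ℕ} (i : Fin (n - 1)) : Fin n := ⟨i, by omega⟩

/-- The right strand position `i + 1` moved by the generator `σ i`. -/
def hi {n : ℕ} (i : Fin (n - 1)) : Fin n := ⟨i + 1, by omega⟩

/-- The defining relators of the braid group on `n` strands. -/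
def relators (n : ℕ) : Set (FreeGroup (Fin (n - 1))) :=
  {r | ∃ i j : Fin (n - 1), (i : ℕ) + 1 < j ∧
      r = FreeGroup.of i * FreeGroup.of j * (FreeGroup.of j * FreeGroup.of i)⁻¹} ∪
  {r | ∃ i j : Fin (n - 1), (i : ℕ) + 1 = j ∧
      r = FreeGroup.of i * FreeGroup.of j * FreeGroup.of i *
        (FreeGroup.of j * FreeGroup.of i * FreeGroup.of j)⁻¹}

/-- The braid group `B_n`, by Artin's presentation. -/
abbrev BraidGroup (n : ℕ) : Type := PresentedGroup (relators n)

/-- The standard generators of `B_n`; `σ i` is classically written `σ_{i+1}`. -/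
def σ {n : ℕ} (i : Fin (n - 1)) : BraidGroup n := PresentedGroup.of i

theorem lift_relators {n : ℕ} {H : Type*} [Group H] (f : Fin (n - 1) → H)
    (hcomm : ∀ i j : Fin (n - 1), (i : ℕ) + 1 < j → f i * f j = f j * f i)
    (hbraid : ∀ i j : Fin (n - 1), (i : ℕ) + 1 = j → f i * f j * f i = f j * f i * f j) :
    ∀ r ∈ relators n, FreeGroup.lift f r = 1 := by
  rintro r (⟨i, j, h, rfl⟩ | ⟨i, j, h, rfl⟩)
  · simp only [map_mul, map_inv, FreeGroup.lift_apply_of]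
    rw [hcomm i j h, mul_inv_cancel]
  · simp only [map_mul, map_inv, FreeGroup.lift_apply_of]
    rw [hbraid i j h, mul_inv_cancel]

/-- A homomorphism out of `B_n`, given by elements that satisfy the braid relations. -/
def liftHom {n : ℕ} {H : Type*} [Group H] (f : Fin (n - 1) → H)
    (hcomm : ∀ i j : Fin (n - 1), (i : ℕ) + 1 < j → f i * f j = f j * f i)
    (hbraid : ∀ i j : Fin (n - 1), (i : ℕ) + 1 = j → f i * f j * f i = f j * f i * f j) :
    BraidGroup n →* H :=
  PresentedGroup.toGroup (lift_relators f hcomm hbraid)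

/-- The underlying permutation of a braid: `σ i` goes to the transposition `(i, i + 1)`. -/
def perm (n : ℕ) : BraidGroup n →* Equiv.Perm (Fin n) :=
  liftHom (fun i => Equiv.swap (lo i) (hi i))
    (by
      intro i j h
      have e1 : lo j ≠ lo i := by simp [lo, Fin.ext_iff]; omega
      have e2 : lo j ≠ hi i := by simp [lo, hi, Fin.ext_iff]; omega
      have e3 : hi j ≠ lo i := by simp [lo, hi, Fin.ext_iff]; omega
      have e4 : hi j ≠ hi i := by simp [hi, Fin.ext_iff]; omega
      refine (Equiv.Perm.Disjoint.commute fun x => ?_).eq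
      by_cases h1 : x = lo i
      · subst h1; exact Or.inr (Equiv.swap_apply_of_ne_of_ne e1.symm e3.symm)
      by_cases h2 : x = hi i
      · subst h2; exact Or.inr (Equiv.swap_apply_of_ne_of_ne e2.symm e4.symm)
      exact Or.inl (Equiv.swap_apply_of_ne_of_ne h1 h2))
    (by
      intro i j h
      have e0 : lo j = hi i := by simp [lo, hi, Fin.ext_iff]; omega
      have e1 : lo i ≠ hi i := by simp [lo, hi, Fin.ext_iff]
      have e2 : lo i ≠ hi j := by simp [lo, hi, Fin.ext_iff]; omega
      have e3 : hi i ≠ hi j := by simp [hi, Fin.ext_iff]; omega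
      have l := Equiv.swap_mul_swap_mul_swap e3.symm e2.symm
      have r := Equiv.swap_mul_swap_mul_swap e1 e2
      rw [e0, r, Equiv.swap_comm (lo i) (hi i), Equiv.swap_comm (hi i) (hi j), l, Equiv.swap_comm])

/-- The pure braid group `P_n`. -/
def PureBraidGroup (n : ℕ) : Subgroup (BraidGroup n) := (perm n).ker

/-- The standard inclusion `B_n → B_{n+1}`, which adds a straight strand at the end. -/
def addStrand (n : ℕ) : BraidGroup n →* BraidGroup (n + 1) :=
  liftHom (fun i => σ (n := n + 1) (Fin.castLE (by omega) i))
    (by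
      intro i j h
      have := PresentedGroup.one_of_mem (rels := relators (n + 1))
        (Or.inl ⟨Fin.castLE (by omega) i, Fin.castLE (by omega) j, h, rfl⟩)
      rw [map_mul, map_inv] at this
      exact mul_inv_eq_one.mp this)
    (by
      intro i j h
      have := PresentedGroup.one_of_mem (rels := relators (n + 1))
        (Or.inr ⟨Fin.castLE (by omega) i, Fin.castLE (by omega) j, h, rfl⟩)
      rw [map_mul, map_inv] at this
      exact mul_inv_eq_one.mp this)

/-- The pure braid `(σ_n ⋯ σ_{i+1}) σ_i ^ 2 (σ_n ⋯ σ_{i+1})⁻¹` in `B_{n+1}` (generators counted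
from `1` in this comment), which winds the last strand once around strand `i`. -/
def windingBraid (n : ℕ) (i : Fin n) : BraidGroup (n + 1) :=
  let w : BraidGroup (n + 1) :=
    ((((List.finRange n).filter (fun j => i < j)).reverse).map (fun j => σ (n := n + 1) j)).prod
  w * σ (n := n + 1) i ^ 2 * w⁻¹

/-! ### The action of the braid group on the free group -/

/-- `g_i ↦ g_{i+1}`, `g_{i+1} ↦ g_{i+1}⁻¹ g_i g_{i+1}`, the other generators fixed. -/
def artinFun {n : ℕ} (i : Fin (n - 1)) : FreeGroup (Fin n) →* FreeGroup (Fin n) :=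
  FreeGroup.lift fun j =>
    if j = lo i then FreeGroup.of (hi i)
    else if j = hi i then
      (FreeGroup.of (hi i))⁻¹ * FreeGroup.of (lo i) * FreeGroup.of (hi i)
    else FreeGroup.of j

/-- `g_i ↦ g_i g_{i+1} g_i⁻¹`, `g_{i+1} ↦ g_i`, the other generators fixed. -/
def artinInv {n : ℕ} (i : Fin (n - 1)) : FreeGroup (Fin n) →* FreeGroup (Fin n) :=
  FreeGroup.lift fun j =>
    if j = lo i then
      FreeGroup.of (lo i) * FreeGroup.of (hi i) * (FreeGroup.of (lo i))⁻¹
    else if j = hi i then FreeGroup.of (lo i)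
    else FreeGroup.of j

theorem hi_ne_lo {n : ℕ} (i : Fin (n - 1)) : hi i ≠ lo i := by
  simp [hi, lo, Fin.ext_iff]

/-- The automorphism of `F_n` by which `σ i` acts. -/
def artinAut {n : ℕ} (i : Fin (n - 1)) : MulAut (FreeGroup (Fin n)) :=
  MonoidHom.toMulEquiv (artinFun i) (artinInv i)
    (by
      ext j
      have h := hi_ne_lo i
      by_cases h1 : j = lo i
      · subst h1; simp [artinFun, artinInv, h]
      · by_cases h2 : j = hi i
        · subst h2; simp [artinFun, artinInv, h, mul_assoc]
        · simp [artinFun, artinInv, h1, h2])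
    (by
      ext j
      have h := hi_ne_lo i
      by_cases h1 : j = lo i
      · subst h1; simp [artinFun, artinInv, h, mul_assoc]
      · by_cases h2 : j = hi i
        · subst h2; simp [artinFun, artinInv, h]
        · simp [artinFun, artinInv, h1, h2])

theorem artinAut_of {n : ℕ} (i : Fin (n - 1)) (j : Fin n) :
    artinAut i (FreeGroup.of j) =
      if j = lo i then FreeGroup.of (hi i)
      else if j = hi i then
        (FreeGroup.of (hi i))⁻¹ * FreeGroup.of (lo i) * FreeGroup.of (hi i)
      else FreeGroup.of j := by
  change artinFun i (FreeGroup.of j) = _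
  simp [artinFun]

theorem mulAut_ext {n : ℕ} {a b : MulAut (FreeGroup (Fin n))}
    (h : ∀ j, a (FreeGroup.of j) = b (FreeGroup.of j)) : a = b := by
  apply MulEquiv.toMonoidHom_injective
  ext j
  exact h j

/-- The left action of `B_n` on `F_n` with `β · x = β x β⁻¹` in `F_n ⋊ B_n`; it encodes the relations
`g_{i+1} σ_i = σ_i g_i`, `g_i σ_i = σ_i g_i g_{i+1} g_i⁻¹`, and `g_j σ_i = σ_i g_j` otherwise. -/
def artin (n : ℕ) : BraidGroup n →* MulAut (FreeGroup (Fin n)) :=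
  liftHom artinAut
    (by
      intro i j h
      have e1 : lo j ≠ lo i := by simp [lo, Fin.ext_iff]; omega
      have e2 : lo j ≠ hi i := by simp [lo, hi, Fin.ext_iff]; omega
      have e3 : hi j ≠ lo i := by simp [lo, hi, Fin.ext_iff]; omega
      have e4 : hi j ≠ hi i := by simp [hi, Fin.ext_iff]; omega
      have e5 := hi_ne_lo i
      have e6 := hi_ne_lo j
      apply mulAut_ext
      intro x
      simp only [MulAut.mul_apply, artinAut_of]
      by_cases h1 : x = lo i
      · subst h1; simp [artinAut_of, e1.symm, e2.symm, e3.symm, e4.symm]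
      by_cases h2 : x = hi i
      · subst h2; simp [artinAut_of, e1.symm, e2.symm, e3.symm, e4.symm, e5]
      by_cases h3 : x = lo j
      · subst h3; simp [artinAut_of, e1, e2, e3, e4]
      by_cases h4 : x = hi j
      · subst h4; simp [artinAut_of, e1, e2, e3, e4, e6]
      simp [artinAut_of, h1, h2, h3, h4])
    (by
      intro i j h
      have e0 : lo j = hi i := by simp [lo, hi, Fin.ext_iff]; omega
      have e3 : hi j ≠ lo i := by simp [lo, hi, Fin.ext_iff]; omega
      have e4 : hi j ≠ hi i := by simp [hi, Fin.ext_iff]; omega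
      have e5 := hi_ne_lo i
      apply mulAut_ext
      intro x
      simp only [MulAut.mul_apply, artinAut_of, e0]
      by_cases h1 : x = lo i
      · subst h1; simp [artinAut_of, e0, e3, e4, e3.symm, e5.symm]
      by_cases h2 : x = hi i
      · subst h2; simp [artinAut_of, e0, e3, e4, e3.symm, e5, e5.symm]
      by_cases h4 : x = hi j
      · subst h4
        simp [artinAut_of, e0, e3, e4, e3.symm, e5, e5.symm, mul_assoc]
      simp [artinAut_of, e0, h1, h2, h4])

/-- The semidirect product `F_n ⋊ B_n`. -/
abbrev FreeBraid (n : ℕ) : Type := FreeGroup (Fin n) ⋊[artin n] BraidGroup n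

/-- The semidirect product `F_n ⋊ G`, for a subgroup `G` of `B_n`. -/
abbrev FreeSub {n : ℕ} (G : Subgroup (BraidGroup n)) : Type :=
  FreeGroup (Fin n) ⋊[(artin n).comp G.subtype] G

/-- The inclusion of `F_n ⋊ G` in `F_n ⋊ B_n`. -/
def FreeSub.incl {n : ℕ} (G : Subgroup (BraidGroup n)) : FreeSub G →* FreeBraid n :=
  SemidirectProduct.map (MonoidHom.id _) G.subtype (fun _ => rfl)

/-- The canonical identification of `F_n ⋊ P_n` with `P_{n+1}`: the free generators go to the winding
braids, and a braid in `P_n` to the same braid with a straight strand added. -/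
def IsCanonicalSplitting {n : ℕ}
    (Ψ : FreeSub (PureBraidGroup n) ≃* PureBraidGroup (n + 1)) : Prop :=
  (∀ i : Fin n,
    (Ψ (SemidirectProduct.inl (FreeGroup.of i)) : BraidGroup (n + 1)) = windingBraid n i) ∧
  (∀ β : PureBraidGroup n,
    (Ψ (SemidirectProduct.inr β) : BraidGroup (n + 1)) = addStrand n β)

/-! ### The Long–Moody construction -/

/-- The matrix that is the identity except for the block `[0, g_i; 1, 1 - g_i]` in the rows and
columns `i, i + 1`, with entries in the group ring of `F_n ⋊ B_n`. -/
noncomputable def blockR {n : ℕ} (i : Fin (n - 1)) :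
    Matrix (Fin n) (Fin n) (MonoidAlgebra ℤ (FreeBraid n)) :=
  Matrix.of fun a b =>
    if a = lo i ∧ b = lo i then 0
    else if a = lo i ∧ b = hi i then
      MonoidAlgebra.of ℤ _ (SemidirectProduct.inl (FreeGroup.of (lo i)))
    else if a = hi i ∧ b = lo i then 1
    else if a = hi i ∧ b = hi i then
      1 - MonoidAlgebra.of ℤ _ (SemidirectProduct.inl (FreeGroup.of (lo i)))
    else if a = b then 1 else 0

/-- `φ` is the universal Long–Moody representation, `φ (σ i) = σ i • blockR i`, where `σ i` multiplies
every entry on the left. -/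
def IsUniversalLongMoody {n : ℕ}
    (φ : BraidGroup n →* (Matrix (Fin n) (Fin n) (MonoidAlgebra ℤ (FreeBraid n)))ˣ) : Prop :=
  ∀ i : Fin (n - 1),
    (φ (σ i) : Matrix (Fin n) (Fin n) (MonoidAlgebra ℤ (FreeBraid n))) =
      MonoidAlgebra.of ℤ (FreeBraid n) (SemidirectProduct.inr (σ i)) • blockR i

/-- `ρplus : G → GL(V^n)` is obtained from `ρ : F_n ⋊ G → GL(V)` by applying `ρ` to the entries of
the matrices `φ β`: for `β` in `G` these entries lie in the group ring of `F_n ⋊ G`, so that `φ β` is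
(the image of) a matrix `M` over that ring, and `ρplus β` is the block matrix
`(ρ (M i j))_{i,j}`, with `ρ` extended linearly to the group ring. -/
def IsLongMoody {n : ℕ} {k V : Type*} [CommRing k] [AddCommGroup V] [Module k V]
    (φ : BraidGroup n →* (Matrix (Fin n) (Fin n) (MonoidAlgebra ℤ (FreeBraid n)))ˣ)
    (G : Subgroup (BraidGroup n)) (ρ : Representation k (FreeSub G) V)
    (ρplus : Representation k G (Fin n → V)) : Prop :=
  ∀ β : G, ∃ M : Matrix (Fin n) (Fin n) (MonoidAlgebra ℤ (FreeSub G)),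
    M.map (MonoidAlgebra.mapDomain (FreeSub.incl G)) =
      (φ β : Matrix (Fin n) (Fin n) (MonoidAlgebra ℤ (FreeBraid n))) ∧
    ∀ (v : Fin n → V) (i : Fin n),
      ρplus β v i =
        ∑ j, MonoidAlgebra.lift ℤ (Module.End k V) (FreeSub G) ρ (M i j) (v j)

/-! ### The Gassner representation -/

/-- The affine bijection `a ↦ x_i a + δ_{ij}` of the group ring of the free group. -/
noncomputable def foxPerm {n : ℕ} (j i : Fin n) :
    Equiv.Perm (MonoidAlgebra ℤ (FreeGroup (Fin n))) where
  toFun a := MonoidAlgebra.of ℤ _ (FreeGroup.of i) * a + if i = j then 1 else 0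
  invFun a := MonoidAlgebra.of ℤ _ (FreeGroup.of i)⁻¹ * (a - if i = j then 1 else 0)
  left_inv a := by
    dsimp only
    rw [add_sub_cancel_right, ← mul_assoc, ← map_mul, inv_mul_cancel, map_one, one_mul]
  right_inv a := by
    dsimp only
    rw [← mul_assoc, ← map_mul, mul_inv_cancel, map_one, one_mul, sub_add_cancel]

/-- The Fox derivative `∂w/∂x_j`, the crossed homomorphism with `∂x_i/∂x_j = δ_{ij}` and
`∂(uv)/∂x_j = ∂u/∂x_j + u ∂v/∂x_j`. A word acts on the group ring through the affine maps
`a ↦ x_i a + δ_{ij}`, hence as `a ↦ w a + ∂w/∂x_j`; the derivative is the value at `0`. -/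
noncomputable def fox {n : ℕ} (j : Fin n) (w : FreeGroup (Fin n)) :
    MonoidAlgebra ℤ (FreeGroup (Fin n)) :=
  FreeGroup.lift (foxPerm j) w 0

/-- The ring homomorphism from the group ring of `F_n` to `k` that sends `x_i` to `t_i`. -/
noncomputable def evalAt {n : ℕ} {k : Type*} [CommRing k] (t : Fin n → kˣ) :
    MonoidAlgebra ℤ (FreeGroup (Fin n)) →ₐ[ℤ] k :=
  MonoidAlgebra.lift ℤ k (FreeGroup (Fin n)) ((Units.coeHom k).comp (FreeGroup.lift t))

/-- The matrix of `β` in the unreduced Gassner representation with parameters `t`: the Jacobian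
`∂(β⁻¹ x_i β)/∂x_j`, evaluated at `x_l = t_l`. -/
noncomputable def gassner {n : ℕ} {k : Type*} [CommRing k] (t : Fin n → kˣ)
    (β : PureBraidGroup n) : Matrix (Fin n) (Fin n) k :=
  Matrix.of fun i j => evalAt t (fox j (artin n (β : BraidGroup n)⁻¹ (FreeGroup.of i)))

/-- `ρ'` is the representation of `P_{n+1} ≅ F_n ⋊ P_n` obtained from `ρ` by multiplying the image of
the free generator `g_i` by `t_i`, and keeping the images of the elements of `P_n`. -/
def IsRescaling {n : ℕ} {k V : Type*} [CommRing k] [AddCommGroup V] [Module k V]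
    (Ψ : FreeSub (PureBraidGroup n) ≃* PureBraidGroup (n + 1)) (t : Fin n → kˣ)
    (ρ ρ' : Representation k (PureBraidGroup (n + 1)) V) : Prop :=
  (∀ i : Fin n, ρ' (Ψ (SemidirectProduct.inl (FreeGroup.of i))) =
    (t i : k) • ρ (Ψ (SemidirectProduct.inl (FreeGroup.of i)))) ∧
  (∀ β : PureBraidGroup n,
    ρ' (Ψ (SemidirectProduct.inr β)) = ρ (Ψ (SemidirectProduct.inr β)))

end Braid

/-! Long–Moody side. By the chain rule for Fox derivatives, `jacobian`, with entries `β · ∂(β⁻¹ g_i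
β)/∂g_j`, is multiplicative in `β`. Let `x_j = g_j g_{j+1} ⋯` be the tail products, `D` the row of
Fox derivatives, and `T` the matrix with rows `D x_j - D x_{j+1}`. It is unitriangular, hence
invertible. The automorphism `x ↦ σ_i⁻¹ x σ_i` moves only `x_{i+1}`, so in the basis `T` the
Jacobian of `σ_i` becomes the prescribed block: `φ = T · jacobian · T⁻¹`. The construction works for
any group acting on `F_n`, so for a subgroup of `B_n` the entries lie in the smaller group ring. If
`ρ` is trivial, `ρ_t` sends `g_i` to the scalar `t_i` and `P_n` to `1`; undoing the conjugation by
`T` leaves the evaluated Jacobian, which is the Gassner matrix.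

Splitting. The winding braids satisfy the relations of `F_n ⋊ B_n` (`winding_artin`), which gives
`combing : F_n ⋊ B_n → B_{n+1}`. Its image should be the stabiliser of the last strand, with coset
representatives `c_k = cosetRep n k`. The Schreier factors of `c_k σ_i` define a right action of
`B_{n+1}` on `(F_n ⋊ B_n) × {0, …, n}`. On the last coset `combing q` acts as right multiplication
by `q`, whence injectivity; `combing_act` shows that every pure braid is in the image.

Rescaling. A pure braid sends each `g_i` to a conjugate, so `g_i ↦ t_i` extends to a character of
`F_n ⋊ P_n`, and `ρ_t` is the twist of `ρ` by it. -/

namespace Braid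

/-! ### Fox calculus. -/

open MonoidAlgebra in
theorem lift_foxPerm_apply {n : ℕ} (j : Fin n) (w : FreeGroup (Fin n))
    (a : MonoidAlgebra ℤ (FreeGroup (Fin n))) :
    FreeGroup.lift (foxPerm j) w a = of ℤ _ w * a + fox j w := by
  induction w using FreeGroup.induction_on generalizing a with
  | C1 => simp [fox, ← one_def]
  | of i => simp [fox, foxPerm]
  | inv_of i _ =>
    simp only [fox, map_inv, FreeGroup.lift_apply_of]
    change of ℤ _ (FreeGroup.of i)⁻¹ * (a - _) =
      _ * a + of ℤ _ (FreeGroup.of i)⁻¹ * (0 - _)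
    noncomm_ring
  | mul x y hx hy =>
    have h : fox j (x * y) = of ℤ _ x * fox j y + fox j x := by
      rw [fox, map_mul, Equiv.Perm.mul_apply, hx]; rfl
    rw [map_mul, Equiv.Perm.mul_apply, hy, hx, h, map_mul]
    noncomm_ring

theorem fox_mul {n : ℕ} (j : Fin n) (x y : FreeGroup (Fin n)) :
    fox j (x * y) = fox j x + MonoidAlgebra.of ℤ _ x * fox j y := by
  rw [fox, map_mul, Equiv.Perm.mul_apply, lift_foxPerm_apply, add_comm]; rfl

@[simp] theorem fox_one {n : ℕ} (j : Fin n) : fox j (1 : FreeGroup (Fin n)) = 0 := by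
  simp [fox]

theorem fox_of {n : ℕ} (j i : Fin n) : fox j (FreeGroup.of i) = if i = j then 1 else 0 := by
  simp [fox, foxPerm]

theorem fox_inv {n : ℕ} (j : Fin n) (x : FreeGroup (Fin n)) :
    fox j x⁻¹ = -(MonoidAlgebra.of ℤ _ x⁻¹ * fox j x) := by
  have h := fox_mul j x⁻¹ x
  rw [inv_mul_cancel, fox_one] at h
  exact eq_neg_of_add_eq_zero_left h.symm

/-- The chain rule for Fox derivatives. -/
theorem fox_map {n : ℕ} (f : FreeGroup (Fin n) →* FreeGroup (Fin n)) (j : Fin n)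
    (x : FreeGroup (Fin n)) :
    fox j (f x) = ∑ m, MonoidAlgebra.mapDomainRingHom ℤ f (fox m x) *
      fox j (f (FreeGroup.of m)) := by
  induction x using FreeGroup.induction_on with
  | C1 => simp
  | of i => simp [fox_of, apply_ite]
  | inv_of i h =>
    simp only [map_inv, fox_inv, h, map_neg, map_mul, neg_mul, Finset.sum_neg_distrib,
      Finset.mul_sum, mul_assoc]
    simp
  | mul x y hx hy =>
    rw [map_mul, fox_mul, hx, hy, Finset.mul_sum, ← Finset.sum_add_distrib]
    refine Finset.sum_congr rfl fun m _ => ?_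
    rw [fox_mul, map_add, map_mul, add_mul, mul_assoc]
    simp

/-! ### Unitriangular matrices -/

/-- Each factor pushes the support one superdiagonal further, so nothing is left at `m = n`. -/
theorem pow_apply_eq_zero_of_strictUpper {n : ℕ} {R : Type*} [Ring R] {N : Matrix (Fin n) (Fin n) R}
    (hN : ∀ i j, j ≤ i → N i j = 0) (m : ℕ) :
    ∀ i j : Fin n, (j : ℕ) < i + m → (N ^ m) i j = 0 := by
  induction m with
  | zero => intro i j h; rw [pow_zero, Matrix.one_apply_ne]; rintro rfl; omega
  | succ m ih =>
    intro i j h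
    rw [pow_succ, Matrix.mul_apply]
    refine Finset.sum_eq_zero fun l _ => ?_
    by_cases hl : (l : ℕ) < i + m
    · rw [ih i l hl, zero_mul]
    · rw [hN l j (by rw [Fin.le_def]; omega), mul_zero]

/-- The ring is noncommutative, so nilpotency of `U - 1` takes the place of a determinant. -/
theorem isUnit_of_unitriangular {n : ℕ} {R : Type*} [Ring R] {U : Matrix (Fin n) (Fin n) R}
    (h0 : ∀ i j, j < i → U i j = 0) (h1 : ∀ i, U i i = 1) : IsUnit U := by
  have hN : ∀ i j, j ≤ i → (U - 1) i j = 0 := by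
    intro i j h
    rcases h.lt_or_eq with h | rfl
    · simp [h0 i j h, Matrix.one_apply_ne h.ne']
    · simp [h1]
  have : IsNilpotent (U - 1) := ⟨n, by
    ext i j
    exact pow_apply_eq_zero_of_strictUpper hN n i j (by omega)⟩
  simpa using this.isUnit_add_one

/-! ### The Jacobian of the tail products -/

/-- The product `g_j g_{j+1} ⋯` of the free generators from the `j`-th one on. -/
def tailProd (n j : ℕ) : FreeGroup (Fin n) := (((List.finRange n).drop j).map FreeGroup.of).prod

theorem tailProd_eq {n : ℕ} (j : Fin n) :
    tailProd n j = FreeGroup.of j * tailProd n (j + 1) := by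
  rw [tailProd, List.drop_eq_getElem_cons (by simp)]
  simp [tailProd]

theorem tailProd_of_le {n j : ℕ} (h : n ≤ j) : tailProd n j = 1 := by
  rw [tailProd, List.drop_eq_nil_of_le (by simpa)]; simp

/-- Descending induction adapted to `tailProd_eq`; it also serves for the coset representatives. -/
theorem tailProd_induction {n : ℕ} {p : ℕ → Prop} (m : ℕ) (hm : m ≤ n) (base : p m)
    (step : ∀ j : Fin n, (j : ℕ) < m → p (j + 1) → p j) : ∀ j ≤ m, p j := by
  intro j hj
  induction hj using Nat.decreasingInduction with
  | self => exact base
  | of_succ k hk ih => exact step ⟨k, by omega⟩ hk ih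

theorem fox_tailProd_of_lt {n : ℕ} (l : Fin n) (j : ℕ) (h : (l : ℕ) < j) :
    fox l (tailProd n j) = 0 := by
  rcases le_or_gt n j with hj | hj
  · rw [tailProd_of_le hj, fox_one]
  · revert h
    refine tailProd_induction (p := fun j => (l : ℕ) < j → fox l (tailProd n j) = 0) n le_rfl
      (fun _ => by rw [tailProd_of_le le_rfl, fox_one]) (fun i _ ih hi => ?_) j hj.le
    rw [tailProd_eq, fox_mul, ih (by omega), fox_of, if_neg (by rintro rfl; omega)]
    simp

/-- The Fox derivatives of the differences of consecutive tail products. -/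
noncomputable def tailJac (n : ℕ) : Matrix (Fin n) (Fin n) (MonoidAlgebra ℤ (FreeGroup (Fin n))) :=
  Matrix.of fun j l => fox l (tailProd n j) - fox l (tailProd n (j + 1))

/-- Row `j` is `e_j + (g_j - 1) D x_{j+1}`, and `x_{j+1}` involves only generators after `g_j`. -/
theorem isUnit_tailJac (n : ℕ) : IsUnit (tailJac n) := by
  refine isUnit_of_unitriangular (fun i j h => ?_) (fun i => ?_)
  · rw [Fin.lt_def] at h
    simp [tailJac, fox_tailProd_of_lt j _ h, fox_tailProd_of_lt j (i + 1) (by omega)]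
  · simp [tailJac, tailProd_eq, fox_mul, fox_of, fox_tailProd_of_lt i (i + 1) (by omega)]

/-- The tail Jacobian as an invertible matrix. -/
noncomputable def tailUnit (n : ℕ) :
    (Matrix (Fin n) (Fin n) (MonoidAlgebra ℤ (FreeGroup (Fin n))))ˣ :=
  (isUnit_tailJac n).unit

/-! ### The equivariant Jacobian representation -/

section Jacobian

variable {n : ℕ} {G : Type*} [Group G] (α : G →* MulAut (FreeGroup (Fin n)))

/-- The inclusion of the group ring of the free group in that of a semidirect product. -/
noncomputable def inlRing : MonoidAlgebra ℤ (FreeGroup (Fin n)) →+*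
    MonoidAlgebra ℤ (FreeGroup (Fin n) ⋊[α] G) :=
  MonoidAlgebra.mapDomainRingHom ℤ SemidirectProduct.inl

/-- This is `x β = β (β⁻¹ x β)`, extended linearly. It absorbs the twist of coefficients in the
chain rule. -/
theorem inlRing_mul_inr (β : G) (x : MonoidAlgebra ℤ (FreeGroup (Fin n))) :
    inlRing α x * MonoidAlgebra.of ℤ _ (SemidirectProduct.inr β) =
      MonoidAlgebra.of ℤ _ (SemidirectProduct.inr β) *
        inlRing α (MonoidAlgebra.mapDomainRingHom ℤ (α β⁻¹).toMonoidHom x) := by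
  induction x using MonoidAlgebra.induction_on with
  | of g =>
    simp only [inlRing, MonoidAlgebra.mapDomainRingHom_apply, MonoidAlgebra.of_apply,
      MonoidAlgebra.mapDomain_single, MonoidAlgebra.single_mul_single, mul_one]
    congr 1
    change SemidirectProduct.inl g * _ = _ * SemidirectProduct.inl (α β⁻¹ g)
    rw [map_inv, SemidirectProduct.inl_aut_inv, map_inv]
    group
  | add a b ha hb => simp only [map_add, add_mul, mul_add, ha, hb]
  | smul r a ha => simp only [map_zsmul, smul_mul_assoc, mul_smul_comm, ha]

/-- The Jacobian matrices `β · ∂(β⁻¹ g_i β)/∂g_j`. -/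
noncomputable def jacobian :
    G →* Matrix (Fin n) (Fin n) (MonoidAlgebra ℤ (FreeGroup (Fin n) ⋊[α] G)) where
  toFun β := Matrix.of fun i j => MonoidAlgebra.of ℤ _ (SemidirectProduct.inr β) *
    inlRing α (fox j (α β⁻¹ (FreeGroup.of i)))
  map_one' := by
    ext1 i j
    simp only [inv_one, map_one, MulAut.one_apply, fox_of, Matrix.of_apply, Matrix.one_apply]
    split_ifs <;> simp
  map_mul' β γ := by
    ext1 i j
    -- As `(βγ)⁻¹` acts by `β⁻¹` and then by `γ⁻¹`, the chain rule is needed for the map `γ⁻¹` at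
    -- the word `β⁻¹ g_i β`. Its coefficients are twisted by `γ⁻¹`, exactly as when `γ` is moved to
    -- their left.
    have h := fox_map (α γ⁻¹).toMonoidHom j (α β⁻¹ (FreeGroup.of i))
    simp only [MulEquiv.toMonoidHom_eq_coe, MonoidHom.coe_coe] at h
    simp only [Matrix.of_apply, Matrix.mul_apply, mul_inv_rev, map_mul, MulAut.mul_apply, h,
      map_sum, Finset.mul_sum]
    refine Finset.sum_congr rfl fun m _ => ?_
    have h2 := inlRing_mul_inr α γ (fox m (α β⁻¹ (FreeGroup.of i)))
    rw [mul_assoc, mul_assoc, ← mul_assoc (inlRing α _), h2, mul_assoc]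
    rfl

/-- The change of basis matrix over the group ring of the semidirect product. -/
noncomputable def tailUnitInl :
    (Matrix (Fin n) (Fin n) (MonoidAlgebra ℤ (FreeGroup (Fin n) ⋊[α] G)))ˣ :=
  Units.map (inlRing α).mapMatrix.toMonoidHom (tailUnit n)

/-- The Jacobian representation in the basis of differences of tail products. -/
noncomputable def longMoody :
    G →* (Matrix (Fin n) (Fin n) (MonoidAlgebra ℤ (FreeGroup (Fin n) ⋊[α] G)))ˣ :=
  (MulAut.conj (tailUnitInl α)).toMonoidHom.comp (jacobian α).toHomUnits

theorem coe_longMoody (β : G) :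
    (longMoody α β : Matrix (Fin n) (Fin n) (MonoidAlgebra ℤ (FreeGroup (Fin n) ⋊[α] G))) =
      (tailUnitInl α).val * jacobian α β * (tailUnitInl α)⁻¹.val := rfl

theorem coe_tailUnitInl : (tailUnitInl α).val = (inlRing α).mapMatrix (tailJac n) := rfl

end Jacobian

end Braid

/-! ### Coset representatives and winding braids in `B_{n+1}`. -/

namespace Braid

theorem σ_comm {n : ℕ} {i j : Fin (n - 1)} (h : (i : ℕ) + 1 < j) : σ i * σ j = σ j * σ i := by
  have := PresentedGroup.one_of_mem (rels := relators n) (Or.inl ⟨i, j, h, rfl⟩)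
  rw [map_mul, map_inv] at this
  exact mul_inv_eq_one.mp this

theorem σ_braid {n : ℕ} {i j : Fin (n - 1)} (h : (i : ℕ) + 1 = j) :
    σ i * σ j * σ i = σ j * σ i * σ j := by
  have := PresentedGroup.one_of_mem (rels := relators n) (Or.inr ⟨i, j, h, rfl⟩)
  rw [map_mul, map_inv] at this
  exact mul_inv_eq_one.mp this

@[simp] theorem liftHom_σ {n : ℕ} {H : Type*} [Group H] (f : Fin (n - 1) → H) (h₁ h₂)
    (i : Fin (n - 1)) : liftHom f h₁ h₂ (σ i) = f i :=
  PresentedGroup.toGroup.of _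

@[simp] theorem artin_σ {n : ℕ} (i : Fin (n - 1)) : artin n (σ i) = artinAut i := liftHom_σ _ _ _ i

@[simp] theorem perm_σ {n : ℕ} (i : Fin (n - 1)) : perm n (σ i) = Equiv.swap (lo i) (hi i) :=
  liftHom_σ _ _ _ i

@[elab_as_elim]
theorem braid_induction {n : ℕ} {p : BraidGroup n → Prop} (β : BraidGroup n) (one : p 1)
    (gen : ∀ i, p (σ i)) (mul : ∀ x y, p x → p y → p (x * y)) (inv : ∀ x, p x → p x⁻¹) : p β := by
  have h : β ∈ Subgroup.closure (Set.range (PresentedGroup.of (rels := relators n))) := by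
    rw [PresentedGroup.closure_range_of]; trivial
  induction h using Subgroup.closure_induction with
  | mem x hx => obtain ⟨i, rfl⟩ := hx; exact gen i
  | one => exact one
  | mul x y _ _ hx hy => exact mul x y hx hy
  | inv x _ hx => exact inv x hx

/-- The generators of `B_{n+1}`, indexed by natural numbers. -/
def sig (n i : ℕ) : BraidGroup (n + 1) := if h : i < n then σ (n := n + 1) ⟨i, h⟩ else 1

theorem sig_comm {n i j : ℕ} (h : i + 1 < j) : sig n i * sig n j = sig n j * sig n i := by
  unfold sig
  by_cases hj : j < n
  · rw [dif_pos hj, dif_pos (by omega)]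
    exact σ_comm (n := n + 1) h
  · simp [hj]

theorem sig_braid {n i : ℕ} (h : i + 1 < n) :
    sig n i * sig n (i + 1) * sig n i = sig n (i + 1) * sig n i * sig n (i + 1) := by
  rw [sig, sig, dif_pos h, dif_pos (by omega)]
  exact σ_braid (n := n + 1) rfl

/-- The coset representative `σ_{n-1} ⋯ σ_k` (generators counted from `0`). -/
def cosetRep (n k : ℕ) : BraidGroup (n + 1) :=
  (((List.finRange n).drop k).reverse.map (fun j => σ (n := n + 1) j)).prod

theorem cosetRep_of_le {n k : ℕ} (h : n ≤ k) : cosetRep n k = 1 := by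
  rw [cosetRep, List.drop_eq_nil_of_le (by simpa)]; simp

theorem cosetRep_eq {n k : ℕ} (h : k < n) : cosetRep n k = cosetRep n (k + 1) * sig n k := by
  rw [cosetRep, List.drop_eq_getElem_cons (by simpa)]
  simp [cosetRep, sig, h]

theorem cosetRep_mul_of_lt {n i k : ℕ} (h : i + 1 < k) (hk : k ≤ n) :
    cosetRep n k * sig n i = sig n i * cosetRep n k := by
  induction hk using Nat.decreasingInduction with
  | self => simp [cosetRep_of_le]
  | of_succ k hk ih =>
    rw [cosetRep_eq hk, mul_assoc, ← sig_comm h, ← mul_assoc, ih (by omega), mul_assoc]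

/-- The strand carried across by `c_k` shifts the positions it passes by one. At `k = i` this is the
braid relation; for smaller `k` the extra factor `σ_k` commutes with `σ_{i+1}`. -/
theorem cosetRep_mul_of_gt {n i k : ℕ} (h : k ≤ i) (hi : i + 1 < n) :
    cosetRep n k * sig n (i + 1) = sig n i * cosetRep n k := by
  induction h using Nat.decreasingInduction with
  | self =>
    rw [cosetRep_eq (by omega), cosetRep_eq hi, mul_assoc, mul_assoc, ← mul_assoc (sig n (i + 1)),
      ← sig_braid hi, ← mul_assoc, ← mul_assoc, cosetRep_mul_of_lt (by omega) (by omega)]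
    simp only [mul_assoc]
  | of_succ k hk ih =>
    rw [cosetRep_eq (by omega), mul_assoc, sig_comm (by omega), ← mul_assoc, ih, mul_assoc]

theorem filter_lt_finRange (n : ℕ) (i : Fin n) :
    (List.finRange n).filter (fun j => i < j) = (List.finRange n).drop (i + 1) := by
  rw [← List.take_append_drop (i + 1) (List.finRange n), List.filter_append]
  have h1 : ((List.finRange n).take (i + 1)).filter (fun j => i < j) = [] := by
    rw [List.filter_eq_nil_iff]
    intro a ha
    obtain ⟨m, hm, rfl⟩ := List.mem_take_iff_getElem.mp ha
    simp [Fin.lt_def]; omega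
  have h2 : ((List.finRange n).drop (i + 1)).filter (fun j => i < j) =
      (List.finRange n).drop (i + 1) := by
    rw [List.filter_eq_self]
    intro a ha
    obtain ⟨m, hm, rfl⟩ := List.mem_drop_iff_getElem.mp ha
    simp [Fin.lt_def]; omega
  rw [h1, h2]
  simp

theorem windingBraid_eq (n : ℕ) (i : Fin n) :
    windingBraid n i = cosetRep n (i + 1) * sig n i ^ 2 * (cosetRep n (i + 1))⁻¹ := by
  simp only [windingBraid, filter_lt_finRange]
  simp [cosetRep, sig]

/-- Both sides are `c_{i+1} σ_i²`. The commutation rules below use the winding braids only in this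
form, free of inverses. -/
theorem cosetRep_mul_self {n : ℕ} (i : Fin n) :
    cosetRep n i * sig n i = windingBraid n i * cosetRep n (i + 1) := by
  rw [windingBraid_eq, cosetRep_eq i.2]
  simp [pow_two, mul_assoc]

theorem windingBraid_commute_of_lt {n i : ℕ} {k : Fin n} (h : i + 1 < k) :
    sig n i * windingBraid n k = windingBraid n k * sig n i := by
  apply mul_right_cancel (b := cosetRep n (k + 1))
  rw [mul_assoc, ← cosetRep_mul_self, ← mul_assoc, ← cosetRep_mul_of_lt h k.2.le, mul_assoc,
    sig_comm h, ← mul_assoc, cosetRep_mul_self, mul_assoc, mul_assoc,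
    cosetRep_mul_of_lt (by omega) k.2]

theorem windingBraid_commute_of_gt {n i : ℕ} {k : Fin n} (h : (k : ℕ) < i) (hi : i + 1 < n) :
    sig n i * windingBraid n k = windingBraid n k * sig n i := by
  apply mul_right_cancel (b := cosetRep n (k + 1))
  rw [mul_assoc, ← cosetRep_mul_self, ← mul_assoc, ← cosetRep_mul_of_gt h.le hi, mul_assoc,
    ← sig_comm (i := k) (by omega), ← mul_assoc, cosetRep_mul_self, mul_assoc, mul_assoc,
    cosetRep_mul_of_gt h hi]

theorem sig_mul_windingBraid {n i : ℕ} (h : i + 1 < n) :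
    sig n i * windingBraid n ⟨i, by omega⟩ = windingBraid n ⟨i + 1, h⟩ * sig n i := by
  have e1 := cosetRep_mul_self (n := n) ⟨i, by omega⟩
  have e2 := cosetRep_mul_self (n := n) ⟨i + 1, h⟩
  simp only at e1 e2
  apply mul_right_cancel (b := cosetRep n (i + 1))
  rw [mul_assoc, ← e1, ← mul_assoc, ← cosetRep_mul_of_gt le_rfl h, cosetRep_eq (by omega : i < n),
    mul_assoc, mul_assoc, ← mul_assoc (sig n i), sig_braid h]
  simp only [← mul_assoc]
  rw [e2, mul_assoc (windingBraid _ _), cosetRep_mul_of_lt (by omega) (by omega), mul_assoc,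
    mul_assoc, ← cosetRep_eq h, mul_assoc]

/-- With `sig_mul_windingBraid`, this replaces the conjugation relation between `σ_i` and the two
generators it moves. Multiplied by `c_{i+2}`, the product of winding braids is `c_i σ_i σ_{i+1}`,
and the braid relation applies. -/
theorem sig_mul_windingBraid_mul {n i : ℕ} (h : i + 1 < n) :
    sig n i * (windingBraid n ⟨i, by omega⟩ * windingBraid n ⟨i + 1, h⟩) =
      windingBraid n ⟨i, by omega⟩ * windingBraid n ⟨i + 1, h⟩ * sig n i := by
  have e1 := cosetRep_mul_self (n := n) ⟨i, by omega⟩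
  have e2 := cosetRep_mul_self (n := n) ⟨i + 1, h⟩
  simp only at e1 e2
  have key : windingBraid n ⟨i, by omega⟩ * windingBraid n ⟨i + 1, h⟩ * cosetRep n (i + 2) =
      cosetRep n i * sig n i * sig n (i + 1) := by
    rw [mul_assoc, ← e2, ← mul_assoc, ← e1]
  apply mul_right_cancel (b := cosetRep n (i + 2))
  rw [mul_assoc, key, mul_assoc (windingBraid n _ * _) (sig n i),
    ← cosetRep_mul_of_lt (k := i + 2) (by omega) h, ← mul_assoc (windingBraid n _ * _), key,
    mul_assoc (cosetRep n i) (sig n i), mul_assoc (cosetRep n i) (sig n i * sig n (i + 1)),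
    sig_braid h, mul_assoc (sig n (i + 1)), ← mul_assoc (cosetRep n i) (sig n (i + 1)),
    cosetRep_mul_of_gt le_rfl h]
  simp only [mul_assoc]

end Braid

/-! ### The Jacobian of `σ_i` in the basis of tail products. -/

namespace Braid

theorem artinAut_inv_of {n : ℕ} (i : Fin (n - 1)) (j : Fin n) :
    (artinAut i)⁻¹ (FreeGroup.of j) =
      if j = lo i then FreeGroup.of (lo i) * FreeGroup.of (hi i) * (FreeGroup.of (lo i))⁻¹
      else if j = hi i then FreeGroup.of (lo i)
      else FreeGroup.of j := by
  change artinInv i (FreeGroup.of j) = _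
  simp [artinInv]

theorem artinAut_inv_tailProd_of_gt {n : ℕ} (i : Fin (n - 1)) (j : ℕ) (h : (i : ℕ) + 1 < j) :
    (artinAut i)⁻¹ (tailProd n j) = tailProd n j := by
  rcases le_or_gt n j with hj | hj
  · rw [tailProd_of_le hj, map_one]
  · revert h
    refine tailProd_induction
      (p := fun j => (i : ℕ) + 1 < j → (artinAut i)⁻¹ (tailProd n j) = tailProd n j) n le_rfl
      (fun _ => by rw [tailProd_of_le le_rfl, map_one]) (fun m _ ih hm => ?_) j hj.le
    rw [tailProd_eq, map_mul, ih (by omega), artinAut_inv_of, if_neg, if_neg]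
    · simp [hi, Fin.ext_iff]; omega
    · simp [lo, Fin.ext_iff]; omega

/-- The only tail product that moves. -/
theorem artinAut_inv_tailProd_succ {n : ℕ} (i : Fin (n - 1)) :
    (artinAut i)⁻¹ (tailProd n (i + 1)) = FreeGroup.of (lo i) * tailProd n (i + 2) := by
  have h := tailProd_eq (hi i)
  simp only [hi] at h
  rw [h, map_mul, artinAut_inv_tailProd_of_gt i _ (by omega), artinAut_inv_of]
  simp [lo, hi, Fin.ext_iff]

/-- The product `g_i g_{i+1}` is fixed, and so are the generators before and after it. -/
theorem artinAut_inv_tailProd_of_le {n : ℕ} (i : Fin (n - 1)) (j : ℕ) (h : j ≤ i) :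
    (artinAut i)⁻¹ (tailProd n j) = tailProd n j := by
  refine tailProd_induction (p := fun j => (artinAut i)⁻¹ (tailProd n j) = tailProd n j) i
    (i.2.le.trans (Nat.sub_le _ _)) ?_ (fun m hm ih => ?_) j h
  · have h0 := tailProd_eq (lo i)
    have h1 := tailProd_eq (hi i)
    simp only [lo, hi] at h0 h1
    rw [h0, map_mul, artinAut_inv_tailProd_succ, h1, artinAut_inv_of]
    simp [lo, hi, mul_assoc]
  · rw [tailProd_eq, map_mul, ih, artinAut_inv_of, if_neg, if_neg]
    · simp [hi, Fin.ext_iff]; omega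
    · simp [lo, Fin.ext_iff]; omega

/-- The rows are written as sums of delta functions so that sums against them collapse. -/
theorem blockR_lo {n : ℕ} (i : Fin (n - 1)) (b : Fin n) :
    blockR i (lo i) b = if b = hi i then
      MonoidAlgebra.of ℤ _ (SemidirectProduct.inl (FreeGroup.of (lo i))) else 0 := by
  have h := hi_ne_lo i
  by_cases h1 : b = lo i
  · simp [blockR, h1, h.symm]
  · by_cases h2 : b = hi i
    · simp [blockR, h2, h]
    · simp [blockR, h1, h2, h.symm, Ne.symm h1]

theorem blockR_hi {n : ℕ} (i : Fin (n - 1)) (b : Fin n) :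
    blockR i (hi i) b = (if b = lo i then 1 else 0) + if b = hi i then
      1 - MonoidAlgebra.of ℤ _ (SemidirectProduct.inl (FreeGroup.of (lo i))) else 0 := by
  have h := hi_ne_lo i
  by_cases h1 : b = lo i
  · simp [blockR, h1, h, h.symm]
  · by_cases h2 : b = hi i
    · simp [blockR, h2, h]
    · simp [blockR, h1, h2, h, Ne.symm h2]

theorem blockR_of_ne {n : ℕ} (i : Fin (n - 1)) (a b : Fin n) (h1 : a ≠ lo i) (h2 : a ≠ hi i) :
    blockR i a b = if b = a then 1 else 0 := by
  simp [blockR, h1, h2, eq_comm]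

theorem inlRing_of {n : ℕ} {G : Type*} [Group G] (α : G →* MulAut (FreeGroup (Fin n)))
    (x : FreeGroup (Fin n)) :
    inlRing α (MonoidAlgebra.of ℤ _ x) = MonoidAlgebra.of ℤ _ (SemidirectProduct.inl x) := by
  simp [inlRing]

/-- With `T_j = D x_j - D x_{j+1}`, replacing `x_{i+1}` by `g_i x_{i+2}` turns `T_i` into `D(g_i
x_{i+1}) - D(g_i x_{i+2}) = g_i T_{i+1}` and `T_{i+1}` into `D(g_i x_{i+2}) - D x_{i+2} = T_i + (1 -
g_i) T_{i+1}`. These are the two rows of the block; the other rows do not change. -/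
theorem blockR_mul_tailJac {n : ℕ} (i : Fin (n - 1)) (j l : Fin n) :
    ∑ m, blockR i j m * inlRing (artin n) (tailJac n m l) =
      inlRing (artin n) (fox l ((artinAut i)⁻¹ (tailProd n j)) -
        fox l ((artinAut i)⁻¹ (tailProd n (j + 1)))) := by
  have h := hi_ne_lo i
  by_cases h1 : j = lo i
  · subst h1
    have e := tailProd_eq (lo i)
    simp only [blockR_lo, ite_mul, zero_mul, Finset.sum_ite_eq', Finset.mem_univ, if_true]
    rw [← inlRing_of, ← map_mul]
    rw [artinAut_inv_tailProd_of_le i _ (by simp [lo]), e]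
    simp only [lo] at e ⊢
    rw [artinAut_inv_tailProd_succ, fox_mul, fox_mul]
    congr 1
    simp only [tailJac, hi, lo, Matrix.of_apply]
    noncomm_ring
  · by_cases h2 : j = hi i
    · subst h2
      have e := tailProd_eq (lo i)
      simp only [blockR_hi, add_mul, ite_mul, zero_mul, one_mul, Finset.sum_add_distrib,
        Finset.sum_ite_eq', Finset.mem_univ, if_true]
      rw [← inlRing_of, ← map_one (inlRing (artin n)), ← map_sub, ← map_mul, ← map_add]
      simp only [hi]
      rw [artinAut_inv_tailProd_succ, artinAut_inv_tailProd_of_gt i _ (by omega), fox_mul]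
      congr 1
      simp only [tailJac, Matrix.of_apply, e, fox_mul]
      simp only [lo]
      noncomm_ring
    · simp only [blockR_of_ne i j _ h1 h2, ite_mul, zero_mul, one_mul,
        Finset.sum_ite_eq', Finset.mem_univ, if_true]
      have h1' : (j : ℕ) ≠ i := by simpa [lo, Fin.ext_iff] using h1
      have h2' : (j : ℕ) ≠ i + 1 := by simpa [hi, Fin.ext_iff] using h2
      rcases lt_or_gt_of_ne h1' with hj | hj
      · rw [artinAut_inv_tailProd_of_le i _ (by omega), artinAut_inv_tailProd_of_le i _ (by omega)]
        simp [tailJac]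
      · rw [artinAut_inv_tailProd_of_gt i _ (by omega), artinAut_inv_tailProd_of_gt i _ (by omega)]
        simp [tailJac]

/-- The chain rule at the tail products instead of the generators. -/
theorem tailJac_mul_jacobian {n : ℕ} {G : Type*} [Group G] (α : G →* MulAut (FreeGroup (Fin n)))
    (β : G) (j l : Fin n) :
    ((tailUnitInl α).val * jacobian α β) j l =
      MonoidAlgebra.of ℤ _ (SemidirectProduct.inr β) *
        inlRing α (fox l (α β⁻¹ (tailProd n j)) - fox l (α β⁻¹ (tailProd n (j + 1)))) := by
  have h1 := fox_map (α β⁻¹).toMonoidHom l (tailProd n j)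
  have h2 := fox_map (α β⁻¹).toMonoidHom l (tailProd n (j + 1))
  simp only [MulEquiv.toMonoidHom_eq_coe, MonoidHom.coe_coe] at h1 h2
  rw [Matrix.mul_apply, h1, h2, ← Finset.sum_sub_distrib, map_sum, Finset.mul_sum]
  refine Finset.sum_congr rfl fun m _ => ?_
  simp only [coe_tailUnitInl, jacobian, MonoidHom.coe_mk, OneHom.coe_mk, Matrix.of_apply,
    RingHom.mapMatrix_apply, Matrix.map_apply]
  rw [← mul_assoc, inlRing_mul_inr, mul_assoc, ← map_mul, ← sub_mul, ← map_sub]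
  rfl

theorem isUniversalLongMoody_longMoody (n : ℕ) : IsUniversalLongMoody (longMoody (artin n)) := by
  intro i
  -- Clearing `T⁻¹` leaves `T · jacobian (σ i) = (σ i • blockR i) · T`.
  rw [coe_longMoody, Units.mul_inv_eq_iff_eq_mul]
  ext1 j l
  rw [tailJac_mul_jacobian, map_inv, artin_σ, ← blockR_mul_tailJac, Matrix.mul_apply,
    Finset.mul_sum]
  refine Finset.sum_congr rfl fun m _ => ?_
  rw [Matrix.smul_apply, smul_eq_mul, mul_assoc]
  rfl

/-- The semidirect product with a subgroup: the Long–Moody matrices are compatible with inclusion. -/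
theorem longMoody_map_incl {n : ℕ} (G : Subgroup (BraidGroup n)) (β : G) :
    (longMoody ((artin n).comp G.subtype) β).val.map (MonoidAlgebra.mapDomain (FreeSub.incl G)) =
      (longMoody (artin n) β).val := by
  have hin : ∀ x, MonoidAlgebra.mapDomainRingHom ℤ (FreeSub.incl G)
      (inlRing ((artin n).comp G.subtype) x) = inlRing (artin n) x := by
    intro x
    have : (MonoidAlgebra.mapDomainRingHom ℤ (FreeSub.incl G)).comp
        (inlRing ((artin n).comp G.subtype)) = inlRing (artin n) := by
      rw [inlRing, inlRing, ← MonoidAlgebra.mapDomainRingHom_comp]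
      congr 1
    exact RingHom.congr_fun this x
  set f := MonoidAlgebra.mapDomainRingHom ℤ (FreeSub.incl G) with hf
  -- Comparing units carries the inverse along, without a formula for it.
  have hU : Units.map f.mapMatrix.toMonoidHom (tailUnitInl ((artin n).comp G.subtype)) =
      tailUnitInl (artin n) := by
    ext1
    ext1 i j
    exact hin _
  have hJ : f.mapMatrix (jacobian ((artin n).comp G.subtype) β) = jacobian (artin n) β := by
    ext1 i j
    simp only [jacobian, MonoidHom.coe_mk, OneHom.coe_mk, Matrix.of_apply,
      RingHom.mapMatrix_apply, Matrix.map_apply, map_mul, hin]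
    congr 1
    simp [hf, FreeSub.incl]
  have hInv : f.mapMatrix (tailUnitInl ((artin n).comp G.subtype))⁻¹.val =
      (tailUnitInl (artin n))⁻¹.val := by
    rw [← hU, ← map_inv]; rfl
  change f.mapMatrix _ = _
  rw [coe_longMoody, map_mul, map_mul, hJ, hInv, coe_longMoody, ← hU]
  rfl

/-! ### Evaluation of the matrices in a representation. -/

section Evaluation

variable {n : ℕ} {k V : Type*} [CommRing k] [AddCommGroup V] [Module k V]
  {G : Type*} [Group G] {α : G →* MulAut (FreeGroup (Fin n))}

/-- Matrices over the group ring act on `V^n`, through a representation on `V`. -/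
noncomputable def matrixAct (ρ : Representation k (FreeGroup (Fin n) ⋊[α] G) V) :
    Matrix (Fin n) (Fin n) (MonoidAlgebra ℤ (FreeGroup (Fin n) ⋊[α] G)) →+*
      Module.End k (Fin n → V) :=
  (endVecRingEquivMatrixEnd (Fin n) k V).symm.toRingHom.comp
    (MonoidAlgebra.lift ℤ (Module.End k V) (FreeGroup (Fin n) ⋊[α] G) ρ).toRingHom.mapMatrix

theorem matrixAct_apply (ρ : Representation k (FreeGroup (Fin n) ⋊[α] G) V)
    (M : Matrix (Fin n) (Fin n) (MonoidAlgebra ℤ (FreeGroup (Fin n) ⋊[α] G)))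
    (v : Fin n → V) (i : Fin n) :
    matrixAct ρ M v i = ∑ j, MonoidAlgebra.lift ℤ (Module.End k V) _ ρ (M i j) (v j) := rfl

/-- The Long–Moody representation on `V^n` of a representation on `V`. -/
noncomputable def longMoodyRep (ρ : Representation k (FreeGroup (Fin n) ⋊[α] G) V) :
    Representation k G (Fin n → V) :=
  (matrixAct ρ).toMonoidHom.comp ((Units.coeHom _).comp (longMoody α))

theorem isLongMoody_longMoodyRep (G : Subgroup (BraidGroup n))
    (ρ : Representation k (FreeSub G) V) :
    IsLongMoody (longMoody (artin n)) G ρ (longMoodyRep ρ) :=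
  fun β => ⟨_, longMoody_map_incl G β, fun _ _ => rfl⟩

/-- If the representation is given by scalars `t_i` on the free generators and trivial on the second
factor, its Long–Moody representation is equivalent to the evaluated Jacobians. -/
theorem exists_equiv_jacobian (t : Fin n → kˣ) (ρ : Representation k (FreeGroup (Fin n) ⋊[α] G) V)
    (hl : ∀ i, ρ (SemidirectProduct.inl (FreeGroup.of i)) = (t i : k) • (1 : Module.End k V))
    (hr : ∀ β, ρ (SemidirectProduct.inr β) = 1) :
    ∃ e : (Fin n → V) ≃ₗ[k] (Fin n → V), ∀ (β : G) (v : Fin n → V) (i : Fin n),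
      e (longMoodyRep ρ β v) i =
        ∑ j, evalAt t (fox j (α β⁻¹ (FreeGroup.of i))) • e v j := by
  let U := Units.map (matrixAct ρ).toMonoidHom (tailUnitInl α)
  have hw : ∀ w : FreeGroup (Fin n), ρ (SemidirectProduct.inl w) =
      ((FreeGroup.lift t w : kˣ) : k) • (1 : Module.End k V) := by
    -- Passing to units gives homomorphisms between groups, which are compared on the free
    -- generators.
    have : (ρ.comp SemidirectProduct.inl).toHomUnits =
        (Units.map (algebraMap k (Module.End k V)).toMonoidHom).comp (FreeGroup.lift t) := by
      ext i : 2
      simp [hl, Algebra.algebraMap_eq_smul_one]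
    intro w
    have := congrArg Units.val (DFunLike.congr_fun this w)
    simpa [Algebra.algebraMap_eq_smul_one] using this
  have hx : ∀ x, MonoidAlgebra.lift ℤ (Module.End k V) _ ρ (inlRing α x) =
      evalAt t x • (1 : Module.End k V) := by
    intro x
    induction x using MonoidAlgebra.induction_on with
    | of g => rw [inlRing_of, MonoidAlgebra.lift_of, hw]; simp [evalAt]
    | add a b ha hb => rw [map_add, map_add, map_add, ha, hb, add_smul]
    | smul r a ha => rw [map_zsmul, map_zsmul, map_zsmul, ha, smul_assoc]
  -- Since `φ = T · jacobian · T⁻¹`, it is `U⁻¹` that carries the Long–Moody action to the Jacobian.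
  refine ⟨LinearMap.GeneralLinearGroup.generalLinearEquiv k _ U⁻¹, fun β v i => ?_⟩
  have key : U⁻¹.val * longMoodyRep ρ β = matrixAct ρ (jacobian α β) * U⁻¹.val := by
    rw [Units.inv_mul_eq_iff_eq_mul, ← mul_assoc]
    change matrixAct ρ (longMoody α β).val = _
    rw [coe_longMoody, map_mul, map_mul]
    rfl
  change (U⁻¹.val * longMoodyRep ρ β) v i = _
  rw [key]
  change matrixAct ρ (jacobian α β) (U⁻¹.val v) i = _
  rw [matrixAct_apply]
  refine Finset.sum_congr rfl fun j _ => ?_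
  simp only [jacobian, MonoidHom.coe_mk, OneHom.coe_mk, Matrix.of_apply]
  rw [map_mul, MonoidAlgebra.lift_of, hr, one_mul, hx]
  rfl

end Evaluation

end Braid

/-! ### The homomorphism from `F_n ⋊ B_n` to `B_{n+1}`. -/

namespace Braid

open SemidirectProduct

@[simp] theorem addStrand_σ {n : ℕ} (i : Fin (n - 1)) : addStrand n (σ i) = sig n i := by
  rw [addStrand, liftHom_σ, sig, dif_pos (by omega)]; rfl

/-- The winding braids as the images of the free generators. -/
def winding (n : ℕ) : FreeGroup (Fin n) →* BraidGroup (n + 1) := FreeGroup.lift (windingBraid n)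

@[simp] theorem winding_of {n : ℕ} (i : Fin n) : winding n (FreeGroup.of i) = windingBraid n i := by
  simp [winding]

/-- Both sides are homomorphisms in `x`, so the commutation rules for winding braids suffice. -/
theorem winding_artinAut {n : ℕ} (i : Fin (n - 1)) (x : FreeGroup (Fin n)) :
    winding n (artinAut i x) = sig n i * winding n x * (sig n i)⁻¹ := by
  have hi' : (i : ℕ) + 1 < n := by omega
  have h : (winding n).comp (artinAut i).toMonoidHom =
      (MulAut.conj (sig n i)).toMonoidHom.comp (winding n) := by
    ext j
    simp only [MonoidHom.comp_apply, MulEquiv.toMonoidHom_eq_coe, MonoidHom.coe_coe,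
      MulAut.conj_apply, artinAut_of, winding_of]
    have e1 := sig_mul_windingBraid hi'
    have e2 := sig_mul_windingBraid_mul hi'
    rw [eq_mul_inv_iff_mul_eq]
    split_ifs with h1 h2
    · subst h1; rw [winding_of]; exact e1.symm
    · subst h2
      simp only [map_mul, map_inv, winding_of]
      rw [mul_assoc, mul_assoc, inv_mul_eq_iff_eq_mul]
      change windingBraid n ⟨i, _⟩ * (windingBraid n ⟨i + 1, _⟩ * sig n i) =
        windingBraid n ⟨i + 1, _⟩ * (sig n i * windingBraid n ⟨i + 1, _⟩)
      rw [← mul_assoc, ← e2, ← mul_assoc, e1, mul_assoc]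
    · rw [winding_of]
      have h1' : (j : ℕ) ≠ i := by simpa [lo, Fin.ext_iff] using h1
      have h2' : (j : ℕ) ≠ i + 1 := by simpa [hi, Fin.ext_iff] using h2
      rcases lt_or_gt_of_ne h1' with h3 | h3
      · exact (windingBraid_commute_of_gt h3 hi').symm
      · exact (windingBraid_commute_of_lt (by omega)).symm
  exact DFunLike.congr_fun h x

theorem winding_artin {n : ℕ} (β : BraidGroup n) (x : FreeGroup (Fin n)) :
    winding n (artin n β x) = addStrand n β * winding n x * (addStrand n β)⁻¹ := by
  induction β using braid_induction generalizing x with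
  | one => simp
  | gen i => rw [artin_σ, winding_artinAut, addStrand_σ]
  | mul a b ha hb => rw [map_mul, MulAut.mul_apply, ha, hb, map_mul]; group
  | inv a ha =>
    -- The hypothesis at `a⁻¹ · x` can be solved for the value wanted.
    have := ha (artin n a⁻¹ x)
    rw [← MulAut.mul_apply, ← map_mul, mul_inv_cancel, map_one, MulAut.one_apply] at this
    rw [map_inv (addStrand n), this]; group

/-- The homomorphism `F_n ⋊ B_n → B_{n+1}`. -/
def combing (n : ℕ) : FreeBraid n →* BraidGroup (n + 1) :=
  SemidirectProduct.lift (winding n) (addStrand n) (fun β => by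
    ext x : 1
    exact winding_artin β _)

@[simp] theorem combing_inl {n : ℕ} (x : FreeGroup (Fin n)) : combing n (inl x) = winding n x :=
  lift_inl _ _ _ _

@[simp] theorem combing_inr {n : ℕ} (β : BraidGroup n) : combing n (inr β) = addStrand n β :=
  lift_inr _ _ _ _

/-! ### The coset action -/

/-- The generators of `B_n` in `F_n ⋊ B_n`, indexed by natural numbers. -/
def gen (n i : ℕ) : FreeBraid n := if h : i < n - 1 then inr (σ (n := n) ⟨i, h⟩) else 1

/-- The Schreier generator `c_k σ_i c_{k'}⁻¹` of the stabiliser of the last strand. -/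
def schreier (n i k : ℕ) : FreeBraid n :=
  if k = i then (if h : i < n then inl (FreeGroup.of ⟨i, h⟩) else 1)
  else if k = i + 1 then 1
  else if i < k then gen n i
  else gen n (i - 1)

theorem combing_gen {n i : ℕ} (h : i + 1 < n) : combing n (gen n i) = sig n i := by
  rw [gen, dif_pos (by omega), combing_inr, addStrand_σ]

/-- This justifies the values of `schreier`: the cases are `cosetRep_mul_self`, `cosetRep_eq` and
the two rules for moving a generator past `c_k`. -/
theorem combing_schreier {n i : ℕ} (hi : i < n) (k : ℕ) (hk : k ≤ n) :
    combing n (schreier n i k) * cosetRep n (Equiv.swap i (i + 1) k) =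
      cosetRep n k * sig n i := by
  unfold schreier
  split_ifs with h1 h2 h3
  · subst h1
    rw [Equiv.swap_apply_left, combing_inl, winding_of]
    exact (cosetRep_mul_self _).symm
  · subst h2
    rw [Equiv.swap_apply_right, map_one, one_mul, cosetRep_eq hi]
  · rw [Equiv.swap_apply_of_ne_of_ne h1 h2, combing_gen (by omega),
      cosetRep_mul_of_lt (by omega) hk]
  · rw [Equiv.swap_apply_of_ne_of_ne h1 h2, combing_gen (by omega)]
    obtain ⟨i, rfl⟩ : ∃ m, i = m + 1 := ⟨i - 1, by omega⟩
    exact (cosetRep_mul_of_gt (by omega) hi).symm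

theorem gen_comm {n i j : ℕ} (h : i + 1 < j) : gen n i * gen n j = gen n j * gen n i := by
  unfold gen
  by_cases hj : j < n - 1
  · rw [dif_pos hj, dif_pos (by omega), ← map_mul, ← map_mul]
    congr 1
    exact σ_comm h
  · simp [hj]

theorem gen_braid {n i : ℕ} (h : i + 2 < n) :
    gen n i * gen n (i + 1) * gen n i = gen n (i + 1) * gen n i * gen n (i + 1) := by
  rw [gen, gen, dif_pos (by omega), dif_pos (by omega), ← map_mul, ← map_mul, ← map_mul, ← map_mul]
  congr 1
  exact σ_braid rfl

theorem gen_mul_inl {n i : ℕ} (h : i + 1 < n) (x : FreeGroup (Fin n)) :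
    gen n i * inl x = inl (artinAut ⟨i, by omega⟩ x) * gen n i := by
  rw [gen, dif_pos (by omega), ← artin_σ, inl_aut, map_inv]
  group

theorem gen_mul_inl_of_ne {n i : ℕ} (h : i + 1 < n) (j : Fin n) (h1 : (j : ℕ) ≠ i)
    (h2 : (j : ℕ) ≠ i + 1) :
    gen n i * inl (FreeGroup.of j) = inl (FreeGroup.of j) * gen n i := by
  rw [gen_mul_inl h, artinAut_of, if_neg, if_neg]
  · simpa [hi, Fin.ext_iff] using h2
  · simpa [lo, Fin.ext_iff] using h1

theorem gen_mul_inl_lo {n i : ℕ} (h : i + 1 < n) :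
    gen n i * inl (FreeGroup.of ⟨i, by omega⟩) = inl (FreeGroup.of ⟨i + 1, h⟩) * gen n i := by
  rw [gen_mul_inl h, artinAut_of]
  simp [lo, hi]

theorem gen_mul_inl_lo_mul_hi {n i : ℕ} (h : i + 1 < n) :
    gen n i * (inl (FreeGroup.of ⟨i, by omega⟩) * inl (FreeGroup.of ⟨i + 1, h⟩)) =
      inl (FreeGroup.of ⟨i, by omega⟩) * inl (FreeGroup.of ⟨i + 1, h⟩) * gen n i := by
  rw [← map_mul, gen_mul_inl h, map_mul, artinAut_of, artinAut_of]
  simp [lo, hi, mul_assoc]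

theorem schreier_self {n i : ℕ} (h : i < n) : schreier n i i = inl (FreeGroup.of ⟨i, h⟩) := by
  simp [schreier, h]

theorem schreier_succ (n i : ℕ) : schreier n i (i + 1) = 1 := by
  simp [schreier]

theorem schreier_of_gt {n i k : ℕ} (h : i + 1 < k) : schreier n i k = gen n i := by
  rw [schreier, if_neg (by omega), if_neg (by omega), if_pos (by omega)]

theorem schreier_of_lt {n i k : ℕ} (h : k < i) : schreier n i k = gen n (i - 1) := by
  rw [schreier, if_neg (by omega), if_neg (by omega), if_neg (by omega)]

theorem swap_succ_of_ne {i k : ℕ} (h : k < i ∨ i + 1 < k) : Equiv.swap i (i + 1) k = k :=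
  Equiv.swap_apply_of_ne_of_ne (by omega) (by omega)

/-- The relations for `cosetStep` have to be checked in `F_n ⋊ B_n` itself: pulling them back from
`B_{n+1}` would presuppose the injectivity of `combing`. -/
theorem schreier_comm {n i j k : ℕ} (hij : i + 1 < j) (hj : j < n) :
    schreier n i k * schreier n j (Equiv.swap i (i + 1) k) =
      schreier n j k * schreier n i (Equiv.swap j (j + 1) k) := by
  rcases lt_trichotomy k i with h | rfl | h
  · rw [swap_succ_of_ne (Or.inl h), swap_succ_of_ne (Or.inl (by omega)), schreier_of_lt h,
      schreier_of_lt (by omega), gen_comm (by omega)]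
  · rw [Equiv.swap_apply_left, swap_succ_of_ne (Or.inl (by omega)), schreier_self (by omega),
      schreier_of_lt (by omega), schreier_of_lt (by omega), gen_mul_inl_of_ne] <;>
      (try dsimp only) <;> omega
  rcases (Nat.succ_le_of_lt h).eq_or_lt with rfl | h
  · rw [Equiv.swap_apply_right, swap_succ_of_ne (Or.inl (by omega)), schreier_succ,
      schreier_of_lt (by omega), schreier_of_lt (by omega), one_mul, mul_one]
  rw [swap_succ_of_ne (i := i) (Or.inr h), schreier_of_gt h]
  rcases lt_trichotomy k j with h' | rfl | h'
  · rw [swap_succ_of_ne (Or.inl h'), schreier_of_lt h', schreier_of_gt h, gen_comm (by omega)]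
  · rw [Equiv.swap_apply_left, schreier_self hj, schreier_of_gt (by omega), gen_mul_inl_of_ne] <;>
      (try dsimp only) <;> omega
  rcases (Nat.succ_le_of_lt h').eq_or_lt with rfl | h'
  · rw [Equiv.swap_apply_right, schreier_succ, schreier_of_gt (by omega), one_mul, mul_one]
  · rw [swap_succ_of_ne (Or.inr h'), schreier_of_gt h', schreier_of_gt h, gen_comm hij]

/-- For `k = i` this says that `σ_i` commutes with `g_i g_{i+1}`, for `k = i + 1` that `σ_i g_i =
g_{i+1} σ_i`; for `k = i + 2` both sides are `σ_i`. Otherwise it is a braid relation, with indices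
lowered by one if `k < i`. -/
theorem schreier_braid {n i k : ℕ} (hi : i + 1 < n) (hk : k ≤ n) :
    schreier n i k * schreier n (i + 1) (Equiv.swap i (i + 1) k) *
        schreier n i (Equiv.swap (i + 1) (i + 2) (Equiv.swap i (i + 1) k)) =
      schreier n (i + 1) k * schreier n i (Equiv.swap (i + 1) (i + 2) k) *
        schreier n (i + 1) (Equiv.swap i (i + 1) (Equiv.swap (i + 1) (i + 2) k)) := by
  have s1 : Equiv.swap i (i + 1) (i + 2) = i + 2 := swap_succ_of_ne (Or.inr (by omega))
  have s2 : Equiv.swap (i + 1) (i + 2) i = i := swap_succ_of_ne (Or.inl (by omega))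
  have a1 := schreier_self (n := n) (i := i) (by omega)
  have a2 := schreier_self hi
  have a3 := schreier_succ n i
  have a4 := schreier_succ n (i + 1)
  have a5 := schreier_of_gt (n := n) (i := i) (k := i + 2) (by omega)
  have a6 : schreier n (i + 1) i = gen n i := schreier_of_lt (by omega)
  rcases lt_or_ge k i with h | h
  · have t1 : Equiv.swap i (i + 1) k = k := swap_succ_of_ne (Or.inl h)
    have t2 : Equiv.swap (i + 1) (i + 2) k = k := swap_succ_of_ne (Or.inl (by omega))
    obtain ⟨m, rfl⟩ : ∃ m, i = m + 1 := ⟨i - 1, by omega⟩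
    rw [t1, t2, t1, schreier_of_lt h, schreier_of_lt (by omega)]
    exact gen_braid (by omega)
  obtain rfl | rfl | rfl | h : k = i ∨ k = i + 1 ∨ k = i + 2 ∨ i + 2 < k := by omega
  · simp only [Equiv.swap_apply_left, s2, a1, a2, a5, a6]
    rw [mul_assoc (gen n k), gen_mul_inl_lo_mul_hi]
  · simp only [Equiv.swap_apply_left, Equiv.swap_apply_right, s1, s2, a1, a2, a3, a4, a5, a6,
      one_mul, mul_one, gen_mul_inl_lo hi]
  · simp only [Equiv.swap_apply_right, s1, a3, a4, a5, a6, one_mul, mul_one]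
  · have t1 : Equiv.swap i (i + 1) k = k := swap_succ_of_ne (Or.inr (by omega))
    have t2 : Equiv.swap (i + 1) (i + 2) k = k := swap_succ_of_ne (Or.inr (by omega))
    rw [t1, t2, t1, schreier_of_gt (by omega), schreier_of_gt (by omega)]
    exact gen_braid (by omega)

theorem val_swap_lo_hi {n : ℕ} (i : Fin (n + 1 - 1)) (k : Fin (n + 1)) :
    ((Equiv.swap (lo i) (hi i) k : Fin (n + 1)) : ℕ) = Equiv.swap (i : ℕ) (i + 1) k := by
  by_cases h1 : k = lo i
  · subst h1; rw [Equiv.swap_apply_left]; simp [lo, hi]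
  by_cases h2 : k = hi i
  · subst h2; rw [Equiv.swap_apply_right]; simp [lo, hi]
  rw [Equiv.swap_apply_of_ne_of_ne h1 h2, Equiv.swap_apply_of_ne_of_ne]
  · simpa [lo, Fin.ext_iff] using h1
  · simpa [hi, Fin.ext_iff] using h2

/-- The action of `σ_i` on the pairs (element of `F_n ⋊ B_n`, coset), by right multiplication. -/
def cosetStep {n : ℕ} (i : Fin (n + 1 - 1)) : Equiv.Perm (FreeBraid n × Fin (n + 1)) where
  toFun p := (p.1 * schreier n i p.2, Equiv.swap (lo i) (hi i) p.2)
  invFun p := (p.1 * (schreier n i (Equiv.swap (lo i) (hi i) p.2 : Fin (n + 1)))⁻¹,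
    Equiv.swap (lo i) (hi i) p.2)
  left_inv p := by simp
  right_inv p := by simp

theorem cosetStep_apply {n : ℕ} (i : Fin (n + 1 - 1)) (q : FreeBraid n) (k : Fin (n + 1)) :
    cosetStep i (q, k) = (q * schreier n i k, Equiv.swap (lo i) (hi i) k) := rfl

/-- The right action of `B_{n+1}` on the pairs (element of `F_n ⋊ B_n`, coset). -/
def cosetAction (n : ℕ) :
    BraidGroup (n + 1) →* (Equiv.Perm (FreeBraid n × Fin (n + 1)))ᵐᵒᵖ :=
  liftHom (fun i => MulOpposite.op (cosetStep i))
    (by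
      intro i j h
      rw [← MulOpposite.op_mul, ← MulOpposite.op_mul]
      congr 1
      ext1 ⟨q, k⟩
      simp only [Equiv.Perm.mul_apply, cosetStep_apply]
      -- The second coordinate moves by `perm`, for which the relation is already known.
      have hp := congrArg (perm (n + 1)) (σ_comm h)
      simp only [map_mul, perm_σ] at hp
      refine Prod.ext ?_ (DFunLike.congr_fun hp.symm k)
      have := schreier_comm (n := n) (k := k) h j.2
      simp only [mul_assoc, val_swap_lo_hi, this])
    (by
      intro i j h
      rw [← MulOpposite.op_mul, ← MulOpposite.op_mul, ← MulOpposite.op_mul, ← MulOpposite.op_mul]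
      congr 1
      ext1 ⟨q, k⟩
      simp only [Equiv.Perm.mul_apply, cosetStep_apply]
      have hp := congrArg (perm (n + 1)) (σ_braid h)
      simp only [map_mul, perm_σ] at hp
      refine Prod.ext ?_ ?_
      · have hj : (i : ℕ) + 1 < n := by omega
        have := schreier_braid (k := k) hj (by omega)
        simp only [mul_assoc] at this
        simp only [mul_assoc, val_swap_lo_hi, ← h, this]
      · exact DFunLike.congr_fun hp k)

/-- The braid `β`, acting from the right on the pairs (element of `F_n ⋊ B_n`, coset). -/
def act {n : ℕ} (β : BraidGroup (n + 1)) : Equiv.Perm (FreeBraid n × Fin (n + 1)) :=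
  (cosetAction n β).unop

theorem act_σ {n : ℕ} (i : Fin (n + 1 - 1)) : act (σ i) = cosetStep i := by
  rw [act, cosetAction, liftHom_σ]; rfl

theorem act_one {n : ℕ} (p : FreeBraid n × Fin (n + 1)) : act 1 p = p := by
  rw [act, map_one]; rfl

theorem act_mul {n : ℕ} (β γ : BraidGroup (n + 1)) (p : FreeBraid n × Fin (n + 1)) :
    act (β * γ) p = act γ (act β p) := by
  rw [act, map_mul]; rfl

theorem act_inv_act {n : ℕ} (β : BraidGroup (n + 1)) (p : FreeBraid n × Fin (n + 1)) :
    act β (act β⁻¹ p) = p := by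
  rw [← act_mul, inv_mul_cancel, act_one]

/-- A right action moves cosets by the inverse permutation, hence `perm` stands on the side of the
result. -/
theorem act_snd {n : ℕ} (β : BraidGroup (n + 1)) (p : FreeBraid n × Fin (n + 1)) :
    perm (n + 1) β (act β p).2 = p.2 := by
  induction β using braid_induction generalizing p with
  | one => rw [act_one, map_one]; rfl
  | gen i => rw [act_σ, perm_σ]; exact Equiv.swap_apply_self _ _ _
  | mul x y hx hy => rw [act_mul, map_mul, Equiv.Perm.mul_apply, hy, hx]
  | inv x hx =>
    rw [map_inv, Equiv.Perm.inv_eq_iff_eq, ← hx (act x⁻¹ p), act_inv_act]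

/-- The map `(q, k) ↦ combing q · c_k` intertwines the action with right multiplication on
`B_{n+1}`. -/
theorem combing_act {n : ℕ} (β : BraidGroup (n + 1)) (p : FreeBraid n × Fin (n + 1)) :
    combing n (act β p).1 * cosetRep n (act β p).2 = combing n p.1 * cosetRep n p.2 * β := by
  induction β using braid_induction generalizing p with
  | one => rw [act_one, mul_one]
  | gen i =>
    obtain ⟨q, k⟩ := p
    have h := combing_schreier (n := n) i.2 k (by omega)
    rw [act_σ, cosetStep_apply, val_swap_lo_hi, map_mul, mul_assoc, h, sig,
      dif_pos (show (i : ℕ) < n from i.2), mul_assoc]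
  | mul x y hx hy => rw [act_mul, hy, hx, mul_assoc]
  | inv x hx => rw [eq_mul_inv_iff_mul_eq, ← hx, act_inv_act]

/-- Each factor `σ_j` of `c_k` moves coset `j + 1` to `j`, where the Schreier factor is `1`. -/
theorem act_cosetRep {n : ℕ} (q : FreeBraid n) (k : Fin (n + 1)) :
    act (cosetRep n k) (q, Fin.last n) = (q, k) := by
  suffices ∀ j ≤ n, ∀ h : j < n + 1, act (cosetRep n j) (q, Fin.last n) = (q, ⟨j, h⟩) from
    this k (by omega) k.2
  refine tailProd_induction n le_rfl (fun h => ?_) (fun j _ ih h => ?_)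
  · rw [cosetRep_of_le le_rfl, act_one]; rfl
  · rw [cosetRep_eq j.2, act_mul, ih (by omega), sig, dif_pos j.2, act_σ, cosetStep_apply]
    have : (⟨j + 1, by omega⟩ : Fin (n + 1)) = hi (n := n + 1) j := rfl
    simp only [schreier_succ, mul_one, Prod.mk.injEq, true_and]
    exact this ▸ Equiv.swap_apply_right _ _

theorem act_windingBraid {n : ℕ} (q : FreeBraid n) (i : Fin n) :
    act (windingBraid n i) (q, Fin.last n) = (q * inl (FreeGroup.of i), Fin.last n) := by
  -- Acting further by `c_{i+1}` turns the winding braid into `c_i σ_i`, by `cosetRep_mul_self`.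
  apply (act (cosetRep n (i + 1))).injective
  have h1 := act_cosetRep q i.castSucc
  have h2 := act_cosetRep (q * inl (FreeGroup.of i)) i.succ
  simp only [Fin.val_castSucc, Fin.val_succ] at h1 h2
  rw [h2, ← act_mul, ← cosetRep_mul_self, act_mul, h1, sig, dif_pos i.2, act_σ, cosetStep_apply]
  refine Prod.ext ?_ (Equiv.swap_apply_left _ _)
  simp only [Fin.val_castSucc]
  rw [schreier_self i.2]

/-- The image of `q` in `B_{n+1}` acts on the pairs in the last coset as right multiplication by `q`. -/
theorem act_combing {n : ℕ} (q x : FreeBraid n) :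
    act (combing n q) (x, Fin.last n) = (x * q, Fin.last n) := by
  have hinv : ∀ y : FreeBraid n,
      (∀ x, act (combing n y) (x, Fin.last n) = (x * y, Fin.last n)) →
      ∀ x, act (combing n y⁻¹) (x, Fin.last n) = (x * y⁻¹, Fin.last n) := by
    intro y hy x
    apply (act (combing n y)).injective
    rw [map_inv, act_inv_act, hy, inv_mul_cancel_right]
  have hmul : ∀ y z : FreeBraid n,
      (∀ x, act (combing n y) (x, Fin.last n) = (x * y, Fin.last n)) →
      (∀ x, act (combing n z) (x, Fin.last n) = (x * z, Fin.last n)) →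
      ∀ x, act (combing n (y * z)) (x, Fin.last n) = (x * (y * z), Fin.last n) := by
    intro y z hy hz x
    rw [map_mul, act_mul, hy, hz, mul_assoc]
  have hone : ∀ x, act (combing n 1) (x, Fin.last n) = (x * 1, Fin.last n) := by
    intro x; rw [map_one, act_one, mul_one]
  rw [← inl_left_mul_inr_right q]
  refine hmul _ _ ?_ ?_ x
  · induction q.left using FreeGroup.induction_on with
    | C1 => rw [map_one]; exact hone
    | of i => intro x; rw [combing_inl, winding_of, act_windingBraid]
    | inv_of i h => rw [map_inv]; exact hinv _ h
    | mul a b ha hb => rw [map_mul]; exact hmul _ _ ha hb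
  · induction q.right using braid_induction with
    | one => rw [map_one]; exact hone
    | gen i =>
      intro x
      have hi' : (i : ℕ) + 1 < n := by omega
      -- Here `i + 1 < n`, so the last coset is fixed and its Schreier factor is `gen n i`.
      rw [combing_inr, addStrand_σ, sig, dif_pos (by omega), act_σ, cosetStep_apply]
      refine Prod.ext ?_ (Equiv.swap_apply_of_ne_of_ne ?_ ?_)
      · simp only [Fin.val_last]
        rw [schreier_of_gt hi', gen, dif_pos i.2]
      · simp [lo, Fin.ext_iff]; omega
      · simp [hi, Fin.ext_iff]; omega
    | inv a h => rw [map_inv]; exact hinv _ h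
    | mul a b ha hb => rw [map_mul]; exact hmul _ _ ha hb

/-- The action on `(1, Fin.last n)` recovers the element. -/
theorem combing_injective (n : ℕ) : Function.Injective (combing n) := by
  intro a b h
  have := congrArg (fun β => (act β (1, Fin.last n)).1) h
  simpa [act_combing] using this

/-- A pure braid fixes the last coset, whose representative is `1`, so `combing_act` exhibits a
preimage. -/
theorem exists_combing_eq {n : ℕ} {β : BraidGroup (n + 1)} (h : perm (n + 1) β = 1) :
    ∃ q, combing n q = β := by
  refine ⟨(act β (1, Fin.last n)).1, ?_⟩
  have h1 := combing_act β (1, Fin.last n)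
  have h2 := act_snd β (1, Fin.last n)
  rw [h, Equiv.Perm.one_apply] at h2
  rw [h2] at h1
  simpa [cosetRep_of_le] using h1

/-! ### Splitting of the pure braid group -/

theorem perm_addStrand {n : ℕ} (β : BraidGroup n) (k : Fin n) :
    perm (n + 1) (addStrand n β) k.castSucc = (perm n β k).castSucc := by
  induction β using braid_induction generalizing k with
  | one => simp
  | gen i =>
    rw [addStrand, liftHom_σ, perm_σ, perm_σ]
    exact ((Fin.castSucc_injective n).map_swap (lo i) (hi i) k).symm
  | mul x y hx hy => simp only [map_mul, Equiv.Perm.mul_apply, hx, hy]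
  | inv x hx =>
    rw [map_inv, map_inv, map_inv, Equiv.Perm.inv_eq_iff_eq, hx]; simp

theorem perm_addStrand_last {n : ℕ} (β : BraidGroup n) :
    perm (n + 1) (addStrand n β) (Fin.last n) = Fin.last n := by
  have h := act_snd (combing n (inr β)) (1, Fin.last n)
  rwa [act_combing, combing_inr] at h

theorem perm_addStrand_eq_one_iff {n : ℕ} (β : BraidGroup n) :
    perm (n + 1) (addStrand n β) = 1 ↔ perm n β = 1 := by
  constructor <;> intro h <;> ext1 k
  · apply Fin.castSucc_injective
    rw [← perm_addStrand, h]; rfl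
  · refine Fin.lastCases ?_ (fun k => ?_) k
    · exact perm_addStrand_last β
    · rw [perm_addStrand, h]; rfl

/-- A winding braid is a conjugate of the square of a generator. -/
theorem perm_winding {n : ℕ} (x : FreeGroup (Fin n)) : perm (n + 1) (winding n x) = 1 := by
  have : (perm (n + 1)).comp (winding n) = 1 := by
    ext i : 1
    rw [MonoidHom.comp_apply, winding_of, windingBraid_eq, sig, dif_pos i.2]
    simp only [map_mul, map_inv, perm_σ, pow_two, Equiv.swap_mul_self]
    simp
  exact DFunLike.congr_fun this x

theorem perm_combing {n : ℕ} (q : FreeBraid n) : perm (n + 1) (combing n q) = 1 ↔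
    perm n q.right = 1 := by
  have h : combing n q = winding n q.left * addStrand n q.right := rfl
  rw [← perm_addStrand_eq_one_iff q.right, h, map_mul, perm_winding, one_mul]

theorem incl_injective {n : ℕ} (G : Subgroup (BraidGroup n)) :
    Function.Injective (FreeSub.incl G) := by
  intro a b h
  have h1 := congrArg SemidirectProduct.left h
  have h2 := congrArg SemidirectProduct.right h
  exact SemidirectProduct.ext h1 (Subtype.ext h2)

/-- The isomorphism `F_n ⋊ P_n ≃ P_{n+1}`. -/
noncomputable def splitting (n : ℕ) :
    FreeSub (PureBraidGroup n) ≃* PureBraidGroup (n + 1) :=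
  MulEquiv.ofBijective
    (((combing n).comp (FreeSub.incl (PureBraidGroup n))).codRestrict (PureBraidGroup (n + 1))
      (fun q => (perm_combing _).mpr q.right.2))
    ⟨fun a b h => incl_injective _ (combing_injective n (congrArg Subtype.val h)), fun β => by
      obtain ⟨q, hq⟩ := exists_combing_eq β.2
      refine ⟨⟨q.left, ⟨q.right, (perm_combing q).mp (hq ▸ β.2)⟩⟩, Subtype.ext ?_⟩
      exact hq⟩

theorem coe_splitting (n : ℕ) (q : FreeSub (PureBraidGroup n)) :
    (splitting n q : BraidGroup (n + 1)) = combing n (FreeSub.incl _ q) := rfl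

theorem isCanonicalSplitting_splitting (n : ℕ) : IsCanonicalSplitting (splitting n) :=
  ⟨fun i => by simp [coe_splitting, FreeSub.incl], fun β => by simp [coe_splitting, FreeSub.incl]⟩

end Braid

namespace Braid

open SemidirectProduct

/-! ### Rescaling by characters of `F_n ⋊ P_n`. -/

section Rescaling

variable {n : ℕ} {k V : Type*} [CommRing k] [AddCommGroup V] [Module k V]

/-- The braid group permutes the free generators up to conjugation. -/
theorem lift_artin {A : Type*} [CommGroup A] (β : BraidGroup n) (t : Fin n → A)
    (x : FreeGroup (Fin n)) :
    FreeGroup.lift t (artin n β x) = FreeGroup.lift (fun i => t (perm n β i)) x := by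
  induction β using braid_induction generalizing x t with
  | one => simp
  | gen i =>
    have : (FreeGroup.lift t).comp (artinAut i).toMonoidHom =
        FreeGroup.lift (fun j => t (Equiv.swap (lo i) (hi i) j)) := by
      ext j
      simp only [MonoidHom.comp_apply, MulEquiv.toMonoidHom_eq_coe, MonoidHom.coe_coe,
        artinAut_of, FreeGroup.lift_apply_of]
      split_ifs with h1 h2
      · subst h1; simp
      · subst h2; simp [mul_comm]
      · rw [Equiv.swap_apply_of_ne_of_ne h1 h2, FreeGroup.lift_apply_of]
    rw [artin_σ, perm_σ]
    exact DFunLike.congr_fun this x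
  | mul a b ha hb => rw [map_mul, MulAut.mul_apply, ha, hb, map_mul]; rfl
  | inv a ha =>
    have h := ha (fun i => t (perm n a⁻¹ i)) (artin n a⁻¹ x)
    rw [← MulAut.mul_apply, ← map_mul, mul_inv_cancel, map_one, MulAut.one_apply] at h
    rw [h]
    simp

/-- Purity enters here: it lets arbitrary values `t_i` extend to a character of the semidirect
product. -/
theorem lift_artin_of_mem {A : Type*} [CommGroup A] {β : BraidGroup n} (h : β ∈ PureBraidGroup n)
    (t : Fin n → A) (x : FreeGroup (Fin n)) :
    FreeGroup.lift t (artin n β x) = FreeGroup.lift t x := by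
  have h' : perm n β = 1 := h
  rw [lift_artin, h']; rfl

/-- The character of `F_n ⋊ P_n` with value `t_i` on the free generator `g_i`, trivial on `P_n`. -/
def character {A : Type*} [CommGroup A] (t : Fin n → A) : FreeSub (PureBraidGroup n) →* A :=
  SemidirectProduct.lift (FreeGroup.lift t) 1 (fun β => by
    ext i : 1
    simp only [MonoidHom.comp_apply, MulEquiv.toMonoidHom_eq_coe, MonoidHom.coe_coe,
      MonoidHom.one_apply, map_one, MulAut.one_apply, Subgroup.coe_subtype]
    exact lift_artin_of_mem β.2 t _)

/-- The product of a representation and a character. -/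
def twist {G : Type*} [Group G] (χ : G →* kˣ) (ρ : Representation k G V) :
    Representation k G V where
  toFun g := (χ g : k) • ρ g
  map_one' := by simp
  map_mul' a b := by
    rw [map_mul, map_mul, Units.val_mul, smul_mul_smul_comm]

theorem twist_apply {G : Type*} [Group G] (χ : G →* kˣ) (ρ : Representation k G V) (g : G) :
    twist χ ρ g = (χ g : k) • ρ g := rfl

variable (Ψ : FreeSub (PureBraidGroup n) ≃* PureBraidGroup (n + 1))

/-- The rescaled representation of `P_{n+1}`. -/
def rescale (t : Fin n → kˣ) (ρ : Representation k (PureBraidGroup (n + 1)) V) :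
    Representation k (PureBraidGroup (n + 1)) V :=
  twist ((character t).comp Ψ.symm.toMonoidHom) ρ

theorem rescale_apply (t : Fin n → kˣ) (ρ : Representation k (PureBraidGroup (n + 1)) V)
    (q : FreeSub (PureBraidGroup n)) :
    rescale Ψ t ρ (Ψ q) = (character t q : k) • ρ (Ψ q) := by
  simp [rescale, twist_apply]

theorem isRescaling_rescale (t : Fin n → kˣ) (ρ : Representation k (PureBraidGroup (n + 1)) V) :
    IsRescaling Ψ t ρ (rescale Ψ t ρ) :=
  ⟨fun i => by rw [rescale_apply, character, lift_inl, FreeGroup.lift_apply_of],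
    fun β => by rw [rescale_apply, character, lift_inr]; simp⟩

/-- The two factors generate the semidirect product; units again make the targets groups. -/
theorem IsRescaling.unique {t : Fin n → kˣ} {ρ ρ₁ ρ₂ : Representation k (PureBraidGroup (n + 1)) V}
    (h₁ : IsRescaling Ψ t ρ ρ₁) (h₂ : IsRescaling Ψ t ρ ρ₂) : ρ₁ = ρ₂ := by
  have h : (ρ₁.comp Ψ.toMonoidHom).toHomUnits = (ρ₂.comp Ψ.toMonoidHom).toHomUnits := by
    apply SemidirectProduct.hom_ext
    · ext i : 2
      exact (h₁.1 i).trans (h₂.1 i).symm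
    · ext β : 2
      exact (h₁.2 β).trans (h₂.2 β).symm
  ext1 p
  obtain ⟨q, rfl⟩ := Ψ.surjective p
  exact congrArg Units.val (DFunLike.congr_fun h q)

end Rescaling

end Braid

theorem theorem4p1 {k V : Type*} [CommRing k] [AddCommGroup V] [Module k V] (n : ℕ)
    (ρ : Representation k (Braid.PureBraidGroup (n + 1)) V) :
    ∃ (φ : Braid.BraidGroup n →*
          (Matrix (Fin n) (Fin n) (MonoidAlgebra ℤ (Braid.FreeBraid n)))ˣ)
      (Ψ : Braid.FreeSub (Braid.PureBraidGroup n) ≃* Braid.PureBraidGroup (n + 1))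
      (ρt : (Fin n → kˣ) → Representation k (Braid.PureBraidGroup (n + 1)) V)
      (ρplus : (Fin n → kˣ) → Representation k (Braid.PureBraidGroup n) (Fin n → V)),
      Braid.IsUniversalLongMoody φ ∧
      Braid.IsCanonicalSplitting Ψ ∧
      (∀ t, Braid.IsRescaling Ψ t ρ (ρt t) ∧
        ∀ ρ', Braid.IsRescaling Ψ t ρ ρ' → ρ' = ρt t) ∧
      (∀ t, Braid.IsLongMoody φ (Braid.PureBraidGroup n)
        ((ρt t).comp Ψ.toMonoidHom) (ρplus t)) ∧
      ((∀ p, ρ p = 1) → ∀ t, ∃ e : (Fin n → V) ≃ₗ[k] (Fin n → V),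
        ∀ (β : Braid.PureBraidGroup n) (v : Fin n → V) (i : Fin n),
          e (ρplus t β v) i = ∑ j, Braid.gassner t β i j • e v j) := by
  have hresc := fun t => Braid.isRescaling_rescale (Braid.splitting n) t ρ
  refine ⟨Braid.longMoody (Braid.artin n), Braid.splitting n,
    fun t => Braid.rescale (Braid.splitting n) t ρ,
    fun t => Braid.longMoodyRep
      ((Braid.rescale (Braid.splitting n) t ρ).comp (Braid.splitting n).toMonoidHom),
    Braid.isUniversalLongMoody_longMoody n, Braid.isCanonicalSplitting_splitting n,
    fun t => ⟨hresc t, fun ρ' h => h.unique _ (hresc t)⟩,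
    fun t => Braid.isLongMoody_longMoodyRep _ _, fun hρ t => ?_⟩
  -- For trivial `ρ`, the rescaled representation is scalar on the `g_i` and trivial on `P_n`; the
  -- Jacobian evaluated at `t` is `gassner` by definition.
  refine Braid.exists_equiv_jacobian t _ (fun i => ?_) (fun β => ?_)
  · exact ((hresc t).1 i).trans (by rw [hρ])
  · exact ((hresc t).2 β).trans (hρ _)
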